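/- Let $k$ be a field and let $Q$ be a finite ordered quiver, i.e. a quiver with finitely many vertices and arrows and without oriented cycles (every path from a vertex to itself is trivial); write $Q_0$ for its set of vertices. Let $R$ be a set of relations, i.e. of $k$-linear combinations of paths with a common source and a common target. Denote by $\mathrm{Rep}(Q,R)$ the abelian category of finite-dimensional $k$-linear representations of $Q$ on which all elements of $R$ act as zero. Suppose that $R$ consists of \emph{tensor relations}: only non-trivial paths occur in elements of $R$, the representation with value $k$ at every vertex and identity maps at every arrow satisfies $R$, and $\mathrm{Rep}(Q,R)$ is closed under the vertex-wise tensor product over $k$. Let $D(Q)=D^b(\mathrm{Rep}(Q,R))$ be the bounded derived category, with the tensor product $\otimes$ induced by the (exact) vertex-wise tensor product. A \emph{tensor ideal} of $D(Q)$ is a full thick triangulated subcategory $J$ such that $V\otimes W\in J$ whenever $V\in J$ and $W\in D(Q)$. It is \emph{prime} if it is proper and $V\otimes W\in J$ implies $V\in J$ or $W\in J$. The Balmer spectrum $\mathrm{Spc}\,D(Q)$ is the set of prime tensor ideals, endowed with the topology whose closed sets are the sets $Z(S)=\{P\mid S\cap P=\emptyset\}$ for families $S$ of objects of $D(Q)$.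 For $n\in Q_0$ let $P_n$ be the full subcategory of those objects $V$ of $D(Q)$ whose cohomology vanishes at the vertex $n$, i.e. $H^i(V)_n=0$ for all $i\in\mathbb{Z}$. Theorem. For every $n\in Q_0$ the subcategory $P_n$ is a prime tensor ideal of $D(Q)$, the map $n\mapsto P_n$ is a bijection from $Q_0$ onto $\mathrm{Spc}\,D(Q)$, and the topology of $\mathrm{Spc}\,D(Q)$ is discrete; that is, $\mathrm{Spc}\,D(Q)$ is the discrete space $\{P_n\mid n\in Q_0\}$. In particular, the spectrum remembers only the number of vertices: if $(Q',R')$ is another finite ordered quiver with tensor relations (over a possibly different field $k'$), then $\mathrm{Spc}\,D(Q)$ and $\mathrm{Spc}\,D(Q')$ are homeomorphic if and only if $Q$ and $Q'$ have the same number of vertices. -/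

import Mathlib

open CategoryTheory Limits MonoidalCategory Pretriangulated
open scoped ZeroObject

noncomputable section

namespace QuiverSpc

/-! ### Tensor ideals and the spectrum of a tensor triangulated category -/

section Spectrum

variable {T : Type*} [Category T] [Preadditive T] [HasZeroObject T] [HasShift T ℤ]
  [∀ n : ℤ, (shiftFunctor T n).Additive] [Pretriangulated T] (tens : T ⥤ T ⥤ T)

/-- A tensor ideal: a full, thick (closed under direct summands, hence under isomorphisms)
triangulated subcategory which is stable under tensoring with arbitrary objects. -/
structure IsTensorIdeal (J : ObjectProperty T) : Prop where
  triangulated : J.IsTriangulated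
  thick : J.IsStableUnderRetracts
  tensor_mem : ∀ V W : T, J V → J ((tens.obj V).obj W)

/-- A prime ideal: a proper tensor ideal `P` such that `V ⊗ W ∈ P` implies `V ∈ P` or `W ∈ P`. -/
structure IsPrimeTensorIdeal (P : ObjectProperty T) : Prop extends IsTensorIdeal tens P where
  proper : ∃ V : T, ¬ P V
  mem_or_mem : ∀ V W : T, P ((tens.obj V).obj W) → P V ∨ P W

/-- The set `Spc T` of prime ideals of the tensor triangulated category `(T, tens)`. -/
def Spc : Type _ := { P : ObjectProperty T // IsPrimeTensorIdeal tens P }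

namespace Spc

variable {tens}

/-- The set `Z(S)` of the primes which contain no object of the family `S`. -/
def zeroLocus (S : Set T) : Set (Spc tens) := { P | ∀ V ∈ S, ¬ P.1 V }

lemma biprod_mem_iff (P : Spc tens) (V W : T) : P.1 (V ⊞ W) ↔ P.1 V ∧ P.1 W := by
  have := P.2.triangulated
  have := P.2.thick
  constructor
  · intro h
    exact ⟨P.1.prop_of_retract ⟨biprod.inl, biprod.fst, by simp⟩ h,
      P.1.prop_of_retract ⟨biprod.inr, biprod.snd, by simp⟩ h⟩
  · rintro ⟨hV, hW⟩
    exact P.1.ext_of_isTriangulatedClosed₂ _ (binaryBiproductTriangle_distinguished V W) hV hW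

/-- The Zariski topology: the closed sets are the `Z(S)`, for `S` a set of objects of `T`. -/
instance : TopologicalSpace (Spc tens) :=
  TopologicalSpace.ofClosed { Z | ∃ S : Set T, Z = zeroLocus S }
    ⟨Set.univ, by
      ext P
      have := P.2.triangulated
      have := P.2.thick
      simp only [Set.mem_empty_iff_false, false_iff]
      intro h
      exact h (0 : T) trivial (P.1.prop_of_isZero (isZero_zero T))⟩
    (by
      intro A hA
      refine ⟨⋃₀ { S | zeroLocus S ∈ A }, ?_⟩
      ext P
      constructor
      · rintro h V ⟨S, hS, hV⟩
        exact h _ hS V hV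
      · intro h Z hZ
        obtain ⟨S, rfl⟩ := hA hZ
        exact fun V hV => h V ⟨S, hZ, hV⟩)
    (by
      rintro _ ⟨S, rfl⟩ _ ⟨S', rfl⟩
      refine ⟨{ X | ∃ V ∈ S, ∃ W ∈ S', X = (V ⊞ W : T) }, ?_⟩
      ext P
      constructor
      · rintro (h | h) _ ⟨V, hV, W, hW, rfl⟩ hVW
        · exact h V hV ((biprod_mem_iff P V W).1 hVW).1
        · exact h W hW ((biprod_mem_iff P V W).1 hVW).2
      · intro h
        by_contra! hn
        obtain ⟨h₁, h₂⟩ := not_or.1 hn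
        simp only [zeroLocus, Set.mem_ofPred_eq, not_forall, not_not] at h₁ h₂
        obtain ⟨V, hV, hPV⟩ := h₁
        obtain ⟨W, hW, hPW⟩ := h₂
        exact h _ ⟨V, hV, W, hW, rfl⟩ ((biprod_mem_iff P V W).2 ⟨hPV, hPW⟩))

end Spc

end Spectrum

/-! ### The bounded derived category of an abelian category -/

section BoundedDerived

/-- The property of a cochain complex of being bounded, that is, of having only finitely many
nonzero terms. -/
def boundedComplex (C : Type*) [Category C] [Abelian C] : ObjectProperty (CochainComplex C ℤ) :=
  fun K => ∃ a b : ℤ, K.IsStrictlyGE a ∧ K.IsStrictlyLE b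

variable (C : Type*) [Category C] [Abelian C]

/-- The property of objects of the homotopy category of being a bounded complex. -/
def boundedHomotopy : ObjectProperty (HomotopyCategory C (.up ℤ)) :=
  fun K => boundedComplex C K.as

instance : (boundedHomotopy C).ContainsZero where
  exists_zero :=
    ⟨(HomotopyCategory.quotient _ _).obj 0, Functor.map_isZero _ (isZero_zero _),
      0, 0, inferInstanceAs (CochainComplex.IsStrictlyGE (0 : CochainComplex C ℤ) 0),
      inferInstanceAs (CochainComplex.IsStrictlyLE (0 : CochainComplex C ℤ) 0)⟩

instance : (boundedHomotopy C).IsStableUnderShift ℤ where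
  isStableUnderShiftBy n :=
    { le_shift := by
        rintro K ⟨a, b, ha, hb⟩
        obtain ⟨K : CochainComplex _ _, rfl⟩ := K.quotient_obj_surjective
        rw [ObjectProperty.prop_shift_iff, HomotopyCategory.shift_quotient_obj]
        have ha' : K.IsStrictlyGE a := ha
        have hb' : K.IsStrictlyLE b := hb
        exact ⟨a - n, b - n, K.isStrictlyGE_shift a n (a - n) (by lia),
          K.isStrictlyLE_shift b n (b - n) (by lia)⟩ }

lemma boundedComplex_mappingCone {K L : CochainComplex C ℤ} (f : K ⟶ L)
    (hK : boundedComplex C K) (hL : boundedComplex C L) :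
    boundedComplex C (CochainComplex.mappingCone f) := by
  obtain ⟨a, b, _, _⟩ := hK
  obtain ⟨a', b', _, _⟩ := hL
  refine ⟨min (a - 1) a', max (b - 1) b', ?_, ?_⟩
  · exact CochainComplex.isStrictlyGE_mappingCone f a a' _ (by simp) (by simp)
  · rw [CochainComplex.isStrictlyLE_iff]
    intro i hi
    simp at hi
    simp only [CochainComplex.mappingCone.isZero_X_iff]
    exact ⟨K.isZero_of_isStrictlyLE b _ (by lia), L.isZero_of_isStrictlyLE b' _ (by lia)⟩

instance : (boundedHomotopy C).IsTriangulatedClosed₃ where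
  ext₃' T hT h₁ h₂ := by
    obtain ⟨f : T.obj₁.as ⟶ T.obj₂.as, hf⟩ :=
      (HomotopyCategory.quotient _ _).map_surjective T.mor₁
    refine ⟨_, ?_,
      ⟨Triangle.π₃.mapIso (isoTriangleOfIso₁₂ T _ hT
        (HomotopyCategory.mappingCone_triangleh_distinguished f)
        (Iso.refl _) (Iso.refl _) ?_)⟩⟩
    · exact boundedComplex_mappingCone C f h₁ h₂
    · exact (Category.comp_id _).trans (hf.symm.trans (Category.id_comp _).symm)

instance : (boundedHomotopy C).IsTriangulated where
  toIsTriangulatedClosed₂ := .of_isTriangulatedClosed₃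

/-- The bounded homotopy category `K^b(C)`. -/
abbrev Kb := (boundedHomotopy C).FullSubcategory

/-- The bounded acyclic complexes, as a subcategory of `K^b(C)`. -/
abbrev acyclicKb : ObjectProperty (Kb C) :=
  (HomotopyCategory.subcategoryAcyclic C).inverseImage (boundedHomotopy C).ι

/-- The bounded derived category `D^b(C)`: the Verdier quotient of `K^b(C)` by the subcategory
of acyclic complexes. -/
abbrev Db := (acyclicKb C).trW.Localization

/-- The localization functor `K^b(C) ⥤ D^b(C)`. -/
abbrev Db.Q : Kb C ⥤ Db C := (acyclicKb C).trW.Q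

/-- The morphisms which are inverted in `D^b(C)` are the quasi-isomorphisms. -/
lemma acyclicKb_trW_iff {K L : Kb C} (f : K ⟶ L) :
    (acyclicKb C).trW f ↔ HomotopyCategory.quasiIso C (.up ℤ) f.hom := by
  obtain ⟨M, g, h, mem⟩ := Pretriangulated.distinguished_cocone_triangle f
  have h₁ := (HomotopyCategory.subcategoryAcyclic C).trW_iff_of_distinguished _
    ((boundedHomotopy C).ι.map_distinguished _ mem)
  rw [← HomotopyCategory.quasiIso_eq_trW_subcategoryAcyclic] at h₁
  have h₂ := (acyclicKb C).trW_iff_of_distinguished _ mem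
  exact h₂.trans h₁.symm

instance : (acyclicKb C).trW.ContainsIdentities := inferInstance

/-- The cohomology functor `H^i : D^b(C) ⥤ C`. -/
def Db.cohomology (i : ℤ) : Db C ⥤ C :=
  Localization.lift ((boundedHomotopy C).ι ⋙ HomotopyCategory.homologyFunctor C (.up ℤ) i)
    (fun K L f (hf : (acyclicKb C).trW f) => by
      rw [acyclicKb_trW_iff, HomotopyCategory.mem_quasiIso_iff] at hf
      exact hf i) (Db.Q C)

end BoundedDerived

/-! ### The tensor product on the bounded homotopy category -/

section FiniteCoproducts

variable {C : Type*} [Category C] [Preadditive C] {ι : Type*} {X : ι → C}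

/-- In a preadditive category, a cofan which is split by finitely many projections
is a coproduct. -/
def isColimitOfSplit (c : Cofan X) (s : Finset ι) (p : ∀ i, c.pt ⟶ X i)
    (h₁ : ∀ i, c.inj i ≫ p i = 𝟙 _) (h₂ : ∀ i j, i ≠ j → c.inj i ≫ p j = 0)
    (h₃ : ∑ i ∈ s, p i ≫ c.inj i = 𝟙 c.pt) : IsColimit c :=
  Cofan.IsColimit.mk c (fun t => ∑ i ∈ s, p i ≫ t.inj i)
    (fun t j => by
      classical
      rw [Preadditive.comp_sum]
      by_cases hj : j ∈ s
      · rw [Finset.sum_eq_single_of_mem j hj]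
        · rw [← Category.assoc, h₁, Category.id_comp]
        · intro i _ hi
          rw [← Category.assoc, h₂ j i hi.symm, zero_comp]
      · have h : 𝟙 (X j) = 0 := by
          rw [← h₁ j, ← Category.comp_id (c.inj j), ← h₃, Preadditive.comp_sum,
            Preadditive.sum_comp]
          refine Finset.sum_eq_zero (fun i hi => ?_)
          rw [← Category.assoc (c.inj j), h₂ j i (fun h => hj (h ▸ hi)), zero_comp, zero_comp]
        exact ((IsZero.iff_id_eq_zero _).2 h).eq_of_src _ _)
    (fun t m hm => by
      rw [← Category.id_comp m, ← h₃, Preadditive.sum_comp]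
      exact Finset.sum_congr rfl (fun i _ => by rw [Category.assoc, hm]))

lemma exists_split (c : Cofan X) (hc : IsColimit c) (s : Finset ι)
    (hs : ∀ i, i ∉ s → IsZero (X i)) :
    ∃ p : ∀ i, c.pt ⟶ X i, (∀ i, c.inj i ≫ p i = 𝟙 _) ∧
      (∀ i j, i ≠ j → c.inj i ≫ p j = 0) ∧ ∑ i ∈ s, p i ≫ c.inj i = 𝟙 c.pt := by
  classical
  let p (j : ι) : c.pt ⟶ X j :=
    Cofan.IsColimit.desc hc (fun i => if h : i = j then eqToHom (by rw [h]) else 0)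
  have h₁ (i : ι) : c.inj i ≫ p i = 𝟙 _ := by simp [p, Cofan.IsColimit.fac]
  have h₂ (i j : ι) (h : i ≠ j) : c.inj i ≫ p j = 0 := by simp [p, Cofan.IsColimit.fac, h]
  refine ⟨p, h₁, h₂, Cofan.IsColimit.hom_ext hc _ _ (fun j => ?_)⟩
  rw [Preadditive.comp_sum]
  by_cases hj : j ∈ s
  · rw [Finset.sum_eq_single_of_mem j hj]
    · rw [← Category.assoc, h₁, Category.id_comp, Category.comp_id]
    · intro i _ hi
      rw [← Category.assoc, h₂ j i hi.symm, zero_comp]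
  · exact (hs j hj).eq_of_src _ _

lemma hasCoproduct_of_finite_support [HasFiniteBiproducts C] (s : Finset ι)
    (hs : ∀ i, i ∉ s → IsZero (X i)) : HasCoproduct X := by
  classical
  let c : Cofan X := Cofan.mk (⨁ fun i : s => X i)
    (fun i => if h : i ∈ s then biproduct.ι (fun i : s => X i) ⟨i, h⟩ else 0)
  let p (i : ι) : c.pt ⟶ X i :=
    if h : i ∈ s then biproduct.π (fun i : s => X i) ⟨i, h⟩ else 0
  have hc (i : ι) (h : i ∈ s) : c.inj i = biproduct.ι (fun i : s => X i) ⟨i, h⟩ := by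
    simp [c, h]
  have hp (i : ι) (h : i ∈ s) : p i = biproduct.π (fun i : s => X i) ⟨i, h⟩ := by
    simp [p, h]
  refine ⟨⟨c, isColimitOfSplit c s p (fun i => ?_) (fun i j hij => ?_) ?_⟩⟩
  · by_cases h : i ∈ s
    · rw [hc i h, hp i h, biproduct.ι_π_self]
    · exact (hs i h).eq_of_src _ _
  · by_cases h : i ∈ s
    · by_cases h' : j ∈ s
      · rw [hc i h, hp j h', biproduct.ι_π_ne _ (by simpa using hij)]
      · exact (hs j h').eq_of_tgt _ _
    · exact (hs i h).eq_of_src _ _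
  · rw [← Finset.sum_attach]
    refine Eq.trans (Finset.sum_congr rfl (fun i _ => ?_))
      ((IsBilimit.total (biproduct.isBilimit (fun i : s => X i))))
    rw [hc i i.2, hp i i.2]

/-- An additive functor preserves coproducts of families with finite support. -/
lemma isColimit_map_of_finite_support {D : Type*} [Category D] [Preadditive D] (F : C ⥤ D)
    [F.Additive] (c : Cofan X) (hc : IsColimit c) (s : Finset ι)
    (hs : ∀ i, i ∉ s → IsZero (X i)) :
    Nonempty (IsColimit (Cofan.mk (F.obj c.pt) (fun i => F.map (c.inj i)))) := by
  obtain ⟨p, h₁, h₂, h₃⟩ := exists_split c hc s hs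
  refine ⟨isColimitOfSplit _ s (fun i => F.map (p i)) (fun i => ?_) (fun i j hij => ?_) ?_⟩
  · exact (F.map_comp _ _).symm.trans ((F.congr_map (h₁ i)).trans (F.map_id _))
  · exact (F.map_comp _ _).symm.trans ((F.congr_map (h₂ i j hij)).trans (F.map_zero _ _))
  · have := F.congr_map h₃
    rw [F.map_sum, F.map_id] at this
    refine Eq.trans (Finset.sum_congr rfl (fun i _ => ?_)) this
    exact (F.map_comp _ _).symm

end FiniteCoproducts

section TensorKb

open HomologicalComplex

variable {C : Type*} [Category C] [Abelian C] [MonoidalCategory C] [MonoidalPreadditive C]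

lemma finite_tensor_support (K L : CochainComplex C ℤ) (hK : boundedComplex C K) (n : ℤ) :
    ∃ s : Finset (ComplexShape.π (.up ℤ) (.up ℤ) (.up ℤ) ⁻¹' {n} : Set (ℤ × ℤ)),
      ∀ i, i ∉ s → IsZero (K.X i.1.1 ⊗ L.X i.1.2) := by
  obtain ⟨a, b, _, _⟩ := hK
  have hfin : Set.Finite { i : (ComplexShape.π (.up ℤ) (.up ℤ) (.up ℤ) ⁻¹' {n} : Set (ℤ × ℤ)) |
      i.1.1 ∈ Set.Icc a b } := by
    refine Set.Finite.of_finite_image (f := fun i => i.1.1)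
      ((Set.finite_Icc a b).subset (by rintro _ ⟨i, hi, rfl⟩; exact hi)) ?_
    rintro ⟨⟨i, j⟩, hij⟩ _ ⟨⟨i', j'⟩, hij'⟩ _ h
    have h₁ : i + j = n := hij
    have h₂ : i' + j' = n := hij'
    have h₃ : i = i' := h
    have h₄ : j = j' := by lia
    subst h₃ h₄
    rfl
  refine ⟨hfin.toFinset, fun i hi => ?_⟩
  have hi' : ¬ (a ≤ i.1.1 ∧ i.1.1 ≤ b) := by simpa using hi
  have h : IsZero (K.X i.1.1) := by
    by_cases h : a ≤ i.1.1
    · exact K.isZero_of_isStrictlyLE b _ (by grind)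
    · exact K.isZero_of_isStrictlyGE a _ (by lia)
  exact Functor.map_isZero (tensorRight (L.X i.1.2)) h

instance hasTensor_Kb (K L : Kb C) : HasTensor K.obj.as L.obj.as := fun n => by
  obtain ⟨s, hs⟩ := finite_tensor_support K.obj.as L.obj.as K.property n
  have := HasFiniteBiproducts.of_hasFiniteProducts (C := C)
  exact hasCoproduct_of_finite_support s hs

lemma boundedComplex_tensorObj (K L : Kb C) :
    boundedComplex C (tensorObj K.obj.as L.obj.as) := by
  obtain ⟨a, b, ha, hb⟩ := K.property
  obtain ⟨a', b', ha', hb'⟩ := L.property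
  refine ⟨a + a', b + b', ?_, ?_⟩
  · rw [CochainComplex.isStrictlyGE_iff]
    intro n hn
    rw [IsZero.iff_id_eq_zero]
    refine mapBifunctor.hom_ext (fun i j hij => IsZero.eq_of_src ?_ _ _)
    have hij' : i + j = n := hij
    by_cases h : i < a
    · exact Functor.map_isZero (tensorRight (L.obj.as.X j))
        (CochainComplex.isZero_of_isStrictlyGE K.obj.as a i (by lia))
    · exact Functor.map_isZero (tensorLeft (K.obj.as.X i))
        (CochainComplex.isZero_of_isStrictlyGE L.obj.as a' j (by lia))
  · rw [CochainComplex.isStrictlyLE_iff]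
    intro n hn
    rw [IsZero.iff_id_eq_zero]
    refine mapBifunctor.hom_ext (fun i j hij => IsZero.eq_of_src ?_ _ _)
    have hij' : i + j = n := hij
    by_cases h : b < i
    · exact Functor.map_isZero (tensorRight (L.obj.as.X j))
        (CochainComplex.isZero_of_isStrictlyLE K.obj.as b i (by lia))
    · exact Functor.map_isZero (tensorLeft (K.obj.as.X i))
        (CochainComplex.isZero_of_isStrictlyLE L.obj.as b' j (by lia))

/-- The tensor product of two bounded complexes: the total complex of the double complex
`K.X i ⊗ L.X j`, as an object of `K^b(C)`. -/
def tensorKbObj (K L : Kb C) : Kb C :=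
  ⟨(HomotopyCategory.quotient C (.up ℤ)).obj (tensorObj K.obj.as L.obj.as),
    boundedComplex_tensorObj K L⟩

/-- The class of the morphism of total complexes induced by two morphisms of complexes. -/
def tensorKbHomOf {K K' L L' : Kb C} (f : K.obj.as ⟶ K'.obj.as) (g : L.obj.as ⟶ L'.obj.as) :
    tensorKbObj K L ⟶ tensorKbObj K' L' :=
  ObjectProperty.homMk ((HomotopyCategory.quotient C (.up ℤ)).map (tensorHom f g))

/-- The functoriality of the total tensor product on homotopy classes of morphisms. -/
def tensorKbHom {K K' L L' : Kb C} (f : K ⟶ K') (g : L ⟶ L') :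
    tensorKbObj K L ⟶ tensorKbObj K' L' :=
  tensorKbHomOf (Quot.out f.hom) (Quot.out g.hom)

lemma tensorKbHom_eq {K K' L L' : Kb C} (f : K ⟶ K') (g : L ⟶ L')
    (f' : K.obj.as ⟶ K'.obj.as) (g' : L.obj.as ⟶ L'.obj.as)
    (hf : (HomotopyCategory.quotient C (.up ℤ)).map f' = f.hom)
    (hg : (HomotopyCategory.quotient C (.up ℤ)).map g' = g.hom) :
    tensorKbHom f g = tensorKbHomOf f' g' := by
  have h₁ : Homotopy (Quot.out f.hom) f' :=
    HomotopyCategory.homotopyOfEq _ _ ((HomotopyCategory.quotient_map_out f.hom).trans hf.symm)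
  have h₂ : Homotopy (Quot.out g.hom) g' :=
    HomotopyCategory.homotopyOfEq _ _ ((HomotopyCategory.quotient_map_out g.hom).trans hg.symm)
  have h := (mapBifunctorMapHomotopy₁ h₁ (Quot.out g.hom) (curriedTensor C) (.up ℤ)).trans
    (mapBifunctorMapHomotopy₂ f' h₂ (curriedTensor C) (.up ℤ))
  exact congrArg ObjectProperty.homMk (HomotopyCategory.eq_of_homotopy _ _ h)

lemma tensorKbHom_id (K L : Kb C) : tensorKbHom (𝟙 K) (𝟙 L) = 𝟙 (tensorKbObj K L) := by
  rw [tensorKbHom_eq (𝟙 K) (𝟙 L) (𝟙 _) (𝟙 _) (CategoryTheory.Functor.map_id _ _)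
    (CategoryTheory.Functor.map_id _ _)]
  have h : tensorHom (𝟙 K.obj.as) (𝟙 L.obj.as) = 𝟙 (tensorObj K.obj.as L.obj.as) := by
    ext n i j hij
    simp
  exact congrArg ObjectProperty.homMk
    ((congrArg (HomotopyCategory.quotient C (.up ℤ)).map h).trans (CategoryTheory.Functor.map_id _ _))

lemma tensorKbHom_comp {K K' K'' L L' L'' : Kb C} (f : K ⟶ K') (f' : K' ⟶ K'')
    (g : L ⟶ L') (g' : L' ⟶ L'') :
    tensorKbHom (f ≫ f') (g ≫ g') = tensorKbHom f g ≫ tensorKbHom f' g' := by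
  rw [tensorKbHom_eq (f ≫ f') (g ≫ g') (Quot.out f.hom ≫ Quot.out f'.hom)
    (Quot.out g.hom ≫ Quot.out g'.hom)
    (HomotopyCategory.quotient_map_out_comp_out f.hom f'.hom)
    (HomotopyCategory.quotient_map_out_comp_out g.hom g'.hom)]
  have h : tensorHom (Quot.out f.hom ≫ Quot.out f'.hom) (Quot.out g.hom ≫ Quot.out g'.hom) =
      tensorHom (Quot.out f.hom) (Quot.out g.hom) ≫
        tensorHom (Quot.out f'.hom) (Quot.out g'.hom) := by
    ext n i j hij
    simp [whisker_exchange_assoc]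
  exact congrArg ObjectProperty.homMk
    ((congrArg (HomotopyCategory.quotient C (.up ℤ)).map h).trans (Functor.map_comp _ _ _))

variable (C) in
/-- The tensor product of bounded complexes, as a bifunctor on the bounded homotopy category. -/
def tensorKb : Kb C ⥤ Kb C ⥤ Kb C where
  obj K :=
    { obj := fun L => tensorKbObj K L
      map := fun g => tensorKbHom (𝟙 K) g
      map_id := fun L => tensorKbHom_id K L
      map_comp := fun g g' => by rw [← tensorKbHom_comp, Category.comp_id] }
  map f :=
    { app := fun L => tensorKbHom f (𝟙 L)
      naturality := fun L L' g => by
        simp only [← tensorKbHom_comp, Category.comp_id, Category.id_comp] }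
  map_id K := by
    ext L : 2
    exact tensorKbHom_id K L
  map_comp f f' := by
    ext L : 2
    exact (congrArg (tensorKbHom (f ≫ f')) (Category.comp_id (𝟙 L)).symm).trans
      (tensorKbHom_comp f f' (𝟙 L) (𝟙 L))

end TensorKb

/-! ### Compatibility of the tensor product with monoidal functors -/

section MonoidalFunctor

open HomologicalComplex Functor.LaxMonoidal Functor.OplaxMonoidal

variable {C D : Type*} [Category C] [Abelian C] [MonoidalCategory C] [MonoidalPreadditive C]
  [Category D] [Abelian D] [MonoidalCategory D] [MonoidalPreadditive D]
  (F : C ⥤ D) [F.Additive]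

/-- The functor on bounded homotopy categories which is induced by an additive functor. -/
def mapKb : Kb C ⥤ Kb D :=
  (boundedHomotopy D).lift ((boundedHomotopy C).ι ⋙ F.mapHomotopyCategory (.up ℤ)) (by
    rintro ⟨K, a, b, ha, hb⟩
    exact ⟨a, b,
      inferInstanceAs (CochainComplex.IsStrictlyGE ((F.mapHomologicalComplex _).obj K.as) a),
      inferInstanceAs (CochainComplex.IsStrictlyLE ((F.mapHomologicalComplex _).obj K.as) b)⟩)

variable [F.Monoidal]

/-- The comparison map between the tensor product of the images and the image of the
tensor product, in a given degree. -/
def tensorComparisonX (K L : Kb C) (n : ℤ) :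
    (tensorObj ((mapKb F).obj K).obj.as ((mapKb F).obj L).obj.as).X n ⟶
      F.obj ((tensorObj K.obj.as L.obj.as).X n) :=
  mapBifunctorDesc (fun i j h =>
    (show F.obj (K.obj.as.X i) ⊗ F.obj (L.obj.as.X j) ⟶ _ from
      μ F (K.obj.as.X i) (L.obj.as.X j) ≫ F.map (ιTensorObj K.obj.as L.obj.as i j n h)))

lemma ι_tensorComparisonX (K L : Kb C) (n i j : ℤ) (h : i + j = n) :
    ιTensorObj ((mapKb F).obj K).obj.as ((mapKb F).obj L).obj.as i j n h ≫
      tensorComparisonX F K L n =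
    (show F.obj (K.obj.as.X i) ⊗ F.obj (L.obj.as.X j) ⟶ _ from
      μ F (K.obj.as.X i) (L.obj.as.X j) ≫ F.map (ιTensorObj K.obj.as L.obj.as i j n h)) :=
  ι_mapBifunctorDesc _ _ _ _

instance (K L : Kb C) (n : ℤ) : IsIso (tensorComparisonX F K L n) := by
  obtain ⟨s, hs⟩ := finite_tensor_support K.obj.as L.obj.as K.property n
  obtain ⟨hc⟩ := isColimit_map_of_finite_support F _
    (GradedObject.isColimitCofanMapObj
      ((((curriedTensor C).mapBifunctorHomologicalComplex (.up ℤ) (.up ℤ)).obj K.obj.as).obj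
        L.obj.as).toGradedObject (ComplexShape.π (.up ℤ) (.up ℤ) (.up ℤ)) n) s hs
  let ψ : F.obj ((tensorObj K.obj.as L.obj.as).X n) ⟶
      (tensorObj ((mapKb F).obj K).obj.as ((mapKb F).obj L).obj.as).X n :=
    Cofan.IsColimit.desc hc (fun i => δ F (K.obj.as.X i.1.1) (L.obj.as.X i.1.2) ≫
      ιTensorObj ((mapKb F).obj K).obj.as ((mapKb F).obj L).obj.as i.1.1 i.1.2 n i.2)
  have hψ (i j : ℤ) (h : i + j = n) : F.map (ιTensorObj K.obj.as L.obj.as i j n h) ≫ ψ =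
      δ F (K.obj.as.X i) (L.obj.as.X j) ≫
        ιTensorObj ((mapKb F).obj K).obj.as ((mapKb F).obj L).obj.as i j n h :=
    Cofan.IsColimit.fac hc _ ⟨(i, j), h⟩
  refine ⟨ψ, mapBifunctor.hom_ext (fun i j h => ?_), Cofan.IsColimit.hom_ext hc _ _ ?_⟩
  · refine (Category.assoc _ _ _).symm.trans ?_
    refine (congrArg (· ≫ ψ) (ι_tensorComparisonX F K L n i j h)).trans ?_
    refine (Category.assoc _ _ _).trans ?_
    refine (congrArg (μ F (K.obj.as.X i) (L.obj.as.X j) ≫ ·) (hψ i j h)).trans ?_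
    exact (Functor.Monoidal.μ_δ_assoc F _ _ _).trans (Category.comp_id _).symm
  · rintro ⟨⟨i, j⟩, h⟩
    refine (Category.assoc _ _ _).symm.trans ?_
    refine (congrArg (· ≫ tensorComparisonX F K L n) (hψ i j h)).trans ?_
    refine (Category.assoc _ _ _).trans ?_
    refine (congrArg (δ F (K.obj.as.X i) (L.obj.as.X j) ≫ ·)
      (ι_tensorComparisonX F K L n i j h)).trans ?_
    exact (Functor.Monoidal.δ_μ_assoc F _ _ _).trans (Category.comp_id _).symm

lemma d₁_tensorComparisonX (K L : Kb C) (i j n : ℤ) (hn : i + 1 + j = n) :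
    mapBifunctor.d₁ ((mapKb F).obj K).obj.as ((mapKb F).obj L).obj.as (curriedTensor D)
        (.up ℤ) i j n ≫ tensorComparisonX F K L n =
      (show F.obj (K.obj.as.X i) ⊗ F.obj (L.obj.as.X j) ⟶ _ from
        μ F (K.obj.as.X i) (L.obj.as.X j) ≫ F.map (mapBifunctor.d₁ K.obj.as L.obj.as
          (curriedTensor C) (.up ℤ) i j n)) := by
  rw [mapBifunctor.d₁_eq _ _ _ _ (show (ComplexShape.up ℤ).Rel i (i + 1) from rfl) _ _ hn,
    mapBifunctor.d₁_eq _ _ _ _ (show (ComplexShape.up ℤ).Rel i (i + 1) from rfl) _ _ hn]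
  rw [Linear.units_smul_comp, Category.assoc]
  refine (congrArg (fun x => _ • (_ ≫ x)) (ι_tensorComparisonX F K L n (i + 1) j hn)).trans ?_
  rw [Functor.map_units_smul, Linear.comp_units_smul, F.map_comp]
  refine congrArg (fun x => _ • x) ?_
  exact μ_natural_left_assoc F (K.obj.as.d i (i + 1)) (L.obj.as.X j)
    (F.map (ιTensorObj K.obj.as L.obj.as (i + 1) j n hn))

lemma d₂_tensorComparisonX (K L : Kb C) (i j n : ℤ) (hn : i + (j + 1) = n) :
    mapBifunctor.d₂ ((mapKb F).obj K).obj.as ((mapKb F).obj L).obj.as (curriedTensor D)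
        (.up ℤ) i j n ≫ tensorComparisonX F K L n =
      (show F.obj (K.obj.as.X i) ⊗ F.obj (L.obj.as.X j) ⟶ _ from
        μ F (K.obj.as.X i) (L.obj.as.X j) ≫ F.map (mapBifunctor.d₂ K.obj.as L.obj.as
          (curriedTensor C) (.up ℤ) i j n)) := by
  rw [mapBifunctor.d₂_eq _ _ _ _ _ (show (ComplexShape.up ℤ).Rel j (j + 1) from rfl) _ hn,
    mapBifunctor.d₂_eq _ _ _ _ _ (show (ComplexShape.up ℤ).Rel j (j + 1) from rfl) _ hn]
  rw [Linear.units_smul_comp, Category.assoc]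
  refine (congrArg (fun x => _ • (_ ≫ x)) (ι_tensorComparisonX F K L n i (j + 1) hn)).trans ?_
  rw [Functor.map_units_smul, Linear.comp_units_smul, F.map_comp]
  refine congrArg (fun x => _ • x) ?_
  exact μ_natural_right_assoc F (K.obj.as.X i) (L.obj.as.d j (j + 1))
    (F.map (ιTensorObj K.obj.as L.obj.as i (j + 1) n hn))

/-- The comparison map between the tensor product of the images and the image of the
tensor product. -/
def tensorComparison (K L : Kb C) :
    tensorObj ((mapKb F).obj K).obj.as ((mapKb F).obj L).obj.as ⟶
      (F.mapHomologicalComplex (.up ℤ)).obj (tensorObj K.obj.as L.obj.as) where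
  f n := tensorComparisonX F K L n
  comm' m n hmn := by
    refine mapBifunctor.hom_ext (fun i j h => ?_)
    have h' : i + j = m := h
    have hn : m + 1 = n := hmn
    have e : ιTensorObj K.obj.as L.obj.as i j m h ≫ (tensorObj K.obj.as L.obj.as).d m n =
        mapBifunctor.d₁ K.obj.as L.obj.as (curriedTensor C) (.up ℤ) i j n +
        mapBifunctor.d₂ K.obj.as L.obj.as (curriedTensor C) (.up ℤ) i j n := by
      rw [mapBifunctor.d_eq, Preadditive.comp_add, mapBifunctor.ι_D₁, mapBifunctor.ι_D₂]
    have e' : ιTensorObj ((mapKb F).obj K).obj.as ((mapKb F).obj L).obj.as i j m h ≫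
        (tensorObj ((mapKb F).obj K).obj.as ((mapKb F).obj L).obj.as).d m n =
        mapBifunctor.d₁ ((mapKb F).obj K).obj.as ((mapKb F).obj L).obj.as
          (curriedTensor D) (.up ℤ) i j n +
        mapBifunctor.d₂ ((mapKb F).obj K).obj.as ((mapKb F).obj L).obj.as
          (curriedTensor D) (.up ℤ) i j n := by
      rw [mapBifunctor.d_eq, Preadditive.comp_add, mapBifunctor.ι_D₁, mapBifunctor.ι_D₂]
    refine (Category.assoc _ _ _).symm.trans ?_
    refine (congrArg (· ≫ F.map ((tensorObj K.obj.as L.obj.as).d m n))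
      (ι_tensorComparisonX F K L m i j h)).trans ?_
    refine (Category.assoc _ _ _).trans ?_
    refine (congrArg (μ F (K.obj.as.X i) (L.obj.as.X j) ≫ ·)
      ((F.map_comp _ _).symm.trans (F.congr_map e))).trans ?_
    refine Eq.trans ?_ (Category.assoc _ _ _)
    refine Eq.trans ?_ (congrArg (· ≫ tensorComparisonX F K L n) e').symm
    refine Eq.trans ?_ (Preadditive.add_comp _ _ _ _ _ _).symm
    refine Eq.trans ?_ (congrArg₂ (· + ·) (d₁_tensorComparisonX F K L i j n (by lia))
      (d₂_tensorComparisonX F K L i j n (by lia))).symm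
    exact (congrArg (μ F (K.obj.as.X i) (L.obj.as.X j) ≫ ·) F.map_add).trans
      (Preadditive.comp_add _ _ _ _ _ _)

lemma isIso_tensorComparison (K L : Kb C) : IsIso (tensorComparison F K L) := by
  have (n : ℤ) : IsIso ((tensorComparison F K L).f n) :=
    inferInstanceAs (IsIso (tensorComparisonX F K L n))
  exact HomologicalComplex.Hom.isIso_of_components _

lemma tensorComparison_naturality {K K' L L' : Kb C} (f : K.obj.as ⟶ K'.obj.as)
    (g : L.obj.as ⟶ L'.obj.as)
    (f' : ((mapKb F).obj K).obj.as ⟶ ((mapKb F).obj K').obj.as)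
    (hf : f' = (F.mapHomologicalComplex (.up ℤ)).map f)
    (g' : ((mapKb F).obj L).obj.as ⟶ ((mapKb F).obj L').obj.as)
    (hg : g' = (F.mapHomologicalComplex (.up ℤ)).map g) :
    tensorComparison F K L ≫
      (F.mapHomologicalComplex (.up ℤ)).map (HomologicalComplex.tensorHom f g) =
      HomologicalComplex.tensorHom f' g' ≫ tensorComparison F K' L' := by
  ext n : 1
  refine mapBifunctor.hom_ext (fun i j h => ?_)
  refine (Category.assoc _ _ _).symm.trans ?_
  refine (congrArg (· ≫ F.map ((HomologicalComplex.tensorHom f g).f n))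
    (ι_tensorComparisonX F K L n i j h)).trans ?_
  refine (Category.assoc _ _ _).trans ?_
  refine (congrArg (μ F (K.obj.as.X i) (L.obj.as.X j) ≫ ·)
    ((F.map_comp _ _).symm.trans (F.congr_map
      (ι_mapBifunctorMap f g (curriedTensor C) (.up ℤ) i j n h)))).trans ?_
  refine Eq.trans ?_ (Category.assoc _ _ _)
  refine Eq.trans ?_ (congrArg (· ≫ tensorComparisonX F K' L' n)
    (ι_mapBifunctorMap f' g' (curriedTensor D) (.up ℤ) i j n h)).symm
  refine Eq.trans ?_ ((Category.assoc _ _ _).trans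
    (congrArg (_ ≫ ·) (Category.assoc _ _ _))).symm
  refine Eq.trans ?_ (congrArg (fun x => _ ≫ _ ≫ x)
    (ι_tensorComparisonX F K' L' n i j h)).symm
  subst hf hg
  refine Eq.trans ?_ (congrArg (F.map (f.f i) ▷ F.obj (L.obj.as.X j) ≫ ·)
    (μ_natural_right_assoc F (K'.obj.as.X i) (g.f j)
      (F.map (ιTensorObj K'.obj.as L'.obj.as i j n h)))).symm
  refine Eq.trans ?_ (μ_natural_left_assoc F (f.f i) (L.obj.as.X j)
      (F.map (K'.obj.as.X i ◁ g.f j) ≫ F.map (ιTensorObj K'.obj.as L'.obj.as i j n h))).symm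
  refine congrArg (μ F (K.obj.as.X i) (L.obj.as.X j) ≫ ·) ?_
  exact (F.map_comp _ _).trans (congrArg (F.map (f.f i ▷ L.obj.as.X j) ≫ ·) (F.map_comp _ _))

/-- Images of tensor products of homotopy classes are, up to isomorphisms, tensor products of
images. -/
lemma isIso_mapKb_tensorKbHom {K K' L L' : Kb C} (f : K ⟶ K') (g : L ⟶ L')
    [IsIso ((mapKb F).map f)] [IsIso ((mapKb F).map g)] :
    IsIso ((mapKb F).map (tensorKbHom f g)) := by
  have h₁ : IsIso (tensorKbHom ((mapKb F).map f) ((mapKb F).map g)) :=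
    ⟨tensorKbHom (inv ((mapKb F).map f)) (inv ((mapKb F).map g)), by
      rw [← tensorKbHom_comp, IsIso.hom_inv_id, IsIso.hom_inv_id, tensorKbHom_id], by
      rw [← tensorKbHom_comp, IsIso.inv_hom_id, IsIso.inv_hom_id, tensorKbHom_id]⟩
  let f₀ : K.obj.as ⟶ K'.obj.as := Quot.out f.hom
  let g₀ : L.obj.as ⟶ L'.obj.as := Quot.out g.hom
  let f' : ((mapKb F).obj K).obj.as ⟶ ((mapKb F).obj K').obj.as :=
    (F.mapHomologicalComplex (.up ℤ)).map f₀
  let g' : ((mapKb F).obj L).obj.as ⟶ ((mapKb F).obj L').obj.as :=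
    (F.mapHomologicalComplex (.up ℤ)).map g₀
  have hf : (HomotopyCategory.quotient D (.up ℤ)).map f' = ((mapKb F).map f).hom :=
    congrArg (F.mapHomotopyCategory (.up ℤ)).map (HomotopyCategory.quotient_map_out f.hom)
  have hg : (HomotopyCategory.quotient D (.up ℤ)).map g' = ((mapKb F).map g).hom :=
    congrArg (F.mapHomotopyCategory (.up ℤ)).map (HomotopyCategory.quotient_map_out g.hom)
  rw [tensorKbHom_eq _ _ f' g' hf hg] at h₁
  let c (K L : Kb C) : tensorKbObj ((mapKb F).obj K) ((mapKb F).obj L) ⟶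
      (mapKb F).obj (tensorKbObj K L) :=
    ObjectProperty.homMk ((HomotopyCategory.quotient D (.up ℤ)).map (tensorComparison F K L))
  have hc (K L : Kb C) : IsIso (c K L) := by
    obtain ⟨t, ht, ht'⟩ := isIso_tensorComparison F K L
    exact ⟨ObjectProperty.homMk ((HomotopyCategory.quotient D (.up ℤ)).map t), by
      ext
      exact ((HomotopyCategory.quotient D (.up ℤ)).map_comp _ _).symm.trans
        ((congrArg (HomotopyCategory.quotient D (.up ℤ)).map ht).trans
          ((HomotopyCategory.quotient D (.up ℤ)).map_id _)), by
      ext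
      exact ((HomotopyCategory.quotient D (.up ℤ)).map_comp _ _).symm.trans
        ((congrArg (HomotopyCategory.quotient D (.up ℤ)).map ht').trans
          ((HomotopyCategory.quotient D (.up ℤ)).map_id _))⟩
  have h : c K L ≫ (mapKb F).map (tensorKbHom f g) = tensorKbHomOf f' g' ≫ c K' L' := by
    ext
    exact ((HomotopyCategory.quotient D (.up ℤ)).map_comp _ _).symm.trans
      ((congrArg (HomotopyCategory.quotient D (.up ℤ)).map
        (tensorComparison_naturality F f₀ g₀ f' rfl g' rfl)).trans
        ((HomotopyCategory.quotient D (.up ℤ)).map_comp _ _))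
  have h₂ : IsIso (c K L ≫ (mapKb F).map (tensorKbHom f g)) := by
    rw [h]
    infer_instance
  exact IsIso.of_isIso_comp_left (c K L) _

end MonoidalFunctor

/-! ### Quivers with relations -/

section Quivers

universe u v w

/-- A finite ordered quiver: there are finitely many vertices and arrows, and every path from a
vertex to itself is trivial. -/
class FiniteOrdered (V : Type v) [Quiver.{w} V] : Prop where
  finite_vertices : Finite V
  finite_arrows : ∀ a b : V, Finite (a ⟶ b)
  acyclic : ∀ (a : V) (p : Quiver.Path a a), p = Quiver.Path.nil

variable (k : Type u) [Field k] (V : Type v) [Quiver.{w} V]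

/-- The category of finite dimensional representations over `k` of the quiver `V` (without
relations): the functors from the free category on `V` to finite dimensional vector spaces. -/
abbrev QuiverRep := Paths V ⥤ FGModuleCat.{u} k

/-- Relations on the quiver `V`: sets of `k`-linear combinations of paths with the same source
and the same target. -/
abbrev Relations := ∀ a b : V, Set (Quiver.Path a b →₀ k)

variable {k V}

/-- The action of a linear combination of paths on a representation. -/
def QuiverRep.act (M : QuiverRep k V) {a b : V} (r : Quiver.Path a b →₀ k) :
    M.obj ((Paths.of V).obj a) ⟶ M.obj ((Paths.of V).obj b) :=
  r.sum (fun p c => c • M.map (X := (Paths.of V).obj a) (Y := (Paths.of V).obj b) p)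

/-- The representations which satisfy the relations `R`. -/
def Relations.satisfiedBy (R : Relations k V) : ObjectProperty (QuiverRep k V) :=
  fun M => ∀ (a b : V) (r : Quiver.Path a b →₀ k), r ∈ R a b → M.act r = 0

/-- The category of finite dimensional representations of a quiver with relations. -/
abbrev RelRep (R : Relations k V) := R.satisfiedBy.FullSubcategory

/-- Tensor relations: they involve only non-trivial paths, the unit representation satisfies
them, and the representations which satisfy them are closed under the vertex-wise tensor
product. -/
class IsTensorRelations (R : Relations k V) : Prop where
  nontrivial : ∀ (a b : V) (r : Quiver.Path a b →₀ k), r ∈ R a b → ∀ p ∈ r.support, 0 < p.length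
  monoidal : R.satisfiedBy.IsMonoidal

instance (R : Relations k V) [IsTensorRelations R] : R.satisfiedBy.IsMonoidal :=
  IsTensorRelations.monoidal

lemma QuiverRep.act_naturality {M N : QuiverRep k V} (f : M ⟶ N) {a b : V}
    (r : Quiver.Path a b →₀ k) :
    M.act r ≫ f.app ((Paths.of V).obj b) = f.app ((Paths.of V).obj a) ≫ N.act r := by
  simp only [QuiverRep.act, Finsupp.sum, Preadditive.sum_comp, Preadditive.comp_sum,
    Linear.smul_comp, Linear.comp_smul]
  exact Finset.sum_congr rfl (fun p _ => congrArg (fun x => r p • x) (f.naturality _))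

variable (R : Relations k V)

instance : R.satisfiedBy.IsClosedUnderSubobjects where
  prop_of_mono {M N} f _ hN a b r hr := by
    rw [← cancel_mono (f.app ((Paths.of V).obj b)), QuiverRep.act_naturality, hN a b r hr]
    simp

instance : R.satisfiedBy.IsClosedUnderQuotients where
  prop_of_epi {M N} f _ hM a b r hr := by
    rw [← cancel_epi (f.app ((Paths.of V).obj a)), ← QuiverRep.act_naturality, hM a b r hr]
    simp

instance : R.satisfiedBy.ContainsZero where
  exists_zero := ⟨0, isZero_zero _, fun a _ _ _ =>
    ((((evaluation _ _).obj ((Paths.of V).obj a)).map_isZero (isZero_zero _)).eq_of_src _ _)⟩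

instance : R.satisfiedBy.IsClosedUnderFiniteProducts where
  isClosedUnderLimitsOfShape J _ :=
    { limitsOfShape_le := by
        rintro M ⟨h⟩ a b r hr
        refine (isLimitOfPreserves ((evaluation _ _).obj ((Paths.of V).obj b))
          h.isLimit).hom_ext (fun j => ?_)
        have := h.prop_diag_obj j a b r hr
        exact (QuiverRep.act_naturality (h.π.app j) r).trans (by rw [this]; simp) }

/-- The vector space at a vertex, as a functor. -/
def vertexFunctor (n : V) : RelRep R ⥤ ModuleCat.{u} k :=
  R.satisfiedBy.ι ⋙ (evaluation _ _).obj ((Paths.of V).obj n) ⋙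
    forget₂ (FGModuleCat k) (ModuleCat k)

instance : MonoidalPreadditive (QuiverRep k V) where
  whiskerLeft_zero := by
    intro X Y Z; ext x : 2
    exact MonoidalPreadditive.whiskerLeft_zero
  zero_whiskerRight := by
    intro X Y Z; ext x : 2
    exact MonoidalPreadditive.zero_whiskerRight
  whiskerLeft_add := by
    intro X Y Z f g; ext x : 2
    exact MonoidalPreadditive.whiskerLeft_add (X := X.obj x) (f.app x) (g.app x)
  add_whiskerRight := by
    intro X Y Z f g; ext x : 2
    exact MonoidalPreadditive.add_whiskerRight (X := X.obj x) (f.app x) (g.app x)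

instance (n : V) : (vertexFunctor R n).Additive := by
  unfold vertexFunctor; infer_instance

instance : R.satisfiedBy.ι.PreservesHomology where
  preservesKernels _ _ f := R.satisfiedBy.preservesKernels_ι f
  preservesCokernels _ _ f := R.satisfiedBy.preservesCokernels_ι f

instance (n : V) : (vertexFunctor R n).PreservesHomology where
  preservesKernels _ _ f := by
    have := R.satisfiedBy.preservesKernels_ι f
    unfold vertexFunctor
    infer_instance
  preservesCokernels _ _ f := by
    have := R.satisfiedBy.preservesCokernels_ι f
    unfold vertexFunctor
    infer_instance

instance (x : Paths V) : ((evaluation (Paths V) (FGModuleCat.{u} k)).obj x).Monoidal :=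
  Functor.CoreMonoidal.toMonoidal
    { εIso := Iso.refl _
      μIso := fun _ _ => Iso.refl _ }

instance (n : V) [IsTensorRelations R] : (vertexFunctor R n).Monoidal := by
  unfold vertexFunctor; infer_instance

lemma isIso_of_vertexFunctor {M N : RelRep R} (f : M ⟶ N)
    (h : ∀ n : V, IsIso ((vertexFunctor R n).map f)) : IsIso f := by
  have (x : Paths V) : IsIso (f.hom.app x) := by
    have : IsIso ((forget₂ (FGModuleCat k) (ModuleCat k)).map (f.hom.app x)) := h x
    exact isIso_of_reflects_iso _ (forget₂ (FGModuleCat k) (ModuleCat k))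
  have : IsIso (R.satisfiedBy.ι.map f) := NatIso.isIso_of_isIso_app f.hom
  exact isIso_of_reflects_iso _ R.satisfiedBy.ι

lemma quasiIso_hom_iff {C : Type*} [Category C] [Abelian C] {K L : Kb C} (f : K ⟶ L)
    (f₀ : K.obj.as ⟶ L.obj.as) (h : (HomotopyCategory.quotient C (.up ℤ)).map f₀ = f.hom) :
    HomotopyCategory.quasiIso C (.up ℤ) f.hom ↔ QuasiIso f₀ :=
  (iff_of_eq (congrArg (fun g : K.obj ⟶ L.obj => HomotopyCategory.quasiIso C (.up ℤ) g) h)).symm.trans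
    (HomotopyCategory.quotient_map_mem_quasiIso_iff f₀)

/-- A quasi-isomorphism between bounded complexes of vector spaces is a homotopy equivalence. -/
lemma isIso_of_quasiIso_moduleCat {K L : Kb (ModuleCat.{u} k)} (f : K ⟶ L)
    (hf : HomotopyCategory.quasiIso _ (.up ℤ) f.hom) : IsIso f := by
  let f₀ : K.obj.as ⟶ L.obj.as := Quot.out f.hom
  have hf₀ : (HomotopyCategory.quotient _ (.up ℤ)).map f₀ = f.hom :=
    HomotopyCategory.quotient_map_out f.hom
  obtain ⟨a, b, _, _⟩ := K.property
  obtain ⟨a', b', _, _⟩ := L.property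
  have := CochainComplex.isKProjective_of_projective K.obj.as b
  have := CochainComplex.isKProjective_of_projective L.obj.as b'
  rw [quasiIso_hom_iff f f₀ hf₀, CochainComplex.IsKProjective.quasiIso_iff,
    ← HomotopyCategory.inverseImage_quotient_isomorphisms, MorphismProperty.inverseImage_iff,
    MorphismProperty.isomorphisms.iff] at hf
  have : IsIso ((boundedHomotopy (ModuleCat.{u} k)).ι.map f) :=
    (congrArg (fun g : K.obj ⟶ L.obj => IsIso g) hf₀).mp hf
  exact isIso_of_reflects_iso _ (boundedHomotopy (ModuleCat.{u} k)).ι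

/-- A morphism of complexes of representations is a quasi-isomorphism if and only if it
is one at every vertex. -/
lemma quasiIso_iff_vertexFunctor {K L : CochainComplex (RelRep R) ℤ} (f : K ⟶ L) :
    QuasiIso f ↔ ∀ n : V,
      QuasiIso (((vertexFunctor R n).mapHomologicalComplex (.up ℤ)).map f) := by
  refine ⟨fun h n => HomologicalComplex.quasiIso_map_of_preservesHomology _ _, fun h => ⟨fun i => ?_⟩⟩
  rw [quasiIsoAt_iff, ShortComplex.quasiIso_iff]
  refine isIso_of_vertexFunctor R _ (fun n => ?_)
  have h₁ := (h n).quasiIsoAt i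
  rw [quasiIsoAt_iff, ShortComplex.quasiIso_iff] at h₁
  have e := ShortComplex.mapHomologyIso_hom_naturality
    ((HomologicalComplex.shortComplexFunctor _ (.up ℤ) i).map f) (vertexFunctor R n)
  exact (MorphismProperty.isomorphisms _).arrow_mk_iso_iff
    (Arrow.isoMk (ShortComplex.mapHomologyIso _ (vertexFunctor R n))
      (ShortComplex.mapHomologyIso _ (vertexFunctor R n)) e.symm) |>.1 h₁

lemma trW_iff_isIso_mapKb_vertexFunctor {K L : Kb (RelRep R)} (f : K ⟶ L) :
    (acyclicKb (RelRep R)).trW f ↔ ∀ n : V, IsIso ((mapKb (vertexFunctor R n)).map f) := by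
  let f₀ : K.obj.as ⟶ L.obj.as := Quot.out f.hom
  have hf₀ : (HomotopyCategory.quotient _ (.up ℤ)).map f₀ = f.hom :=
    HomotopyCategory.quotient_map_out f.hom
  have hf₁ (n : V) : (HomotopyCategory.quotient _ (.up ℤ)).map
      (((vertexFunctor R n).mapHomologicalComplex (.up ℤ)).map f₀) =
        ((mapKb (vertexFunctor R n)).map f).hom :=
    congrArg ((vertexFunctor R n).mapHomotopyCategory (.up ℤ)).map hf₀
  rw [acyclicKb_trW_iff, quasiIso_hom_iff f f₀ hf₀, quasiIso_iff_vertexFunctor]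
  refine forall_congr' (fun n => ?_)
  refine (quasiIso_hom_iff ((mapKb (vertexFunctor R n)).map f) _ (hf₁ n)).symm.trans ?_
  refine ⟨isIso_of_quasiIso_moduleCat _, fun h => ?_⟩
  have h' : IsIso ((boundedHomotopy (ModuleCat.{u} k)).ι.map ((mapKb (vertexFunctor R n)).map f)) :=
    inferInstance
  rw [HomotopyCategory.mem_quasiIso_iff]
  intro i
  exact inferInstanceAs (IsIso ((HomotopyCategory.homologyFunctor _ (.up ℤ) i).map
    ((boundedHomotopy (ModuleCat.{u} k)).ι.map ((mapKb (vertexFunctor R n)).map f))))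

/-- The tensor product of quasi-isomorphisms is a quasi-isomorphism. -/
lemma trW_tensorKbHom [IsTensorRelations R] {K K' L L' : Kb (RelRep R)} (f : K ⟶ K') (g : L ⟶ L')
    (hf : (acyclicKb (RelRep R)).trW f) (hg : (acyclicKb (RelRep R)).trW g) :
    (acyclicKb (RelRep R)).trW (tensorKbHom f g) := by
  rw [trW_iff_isIso_mapKb_vertexFunctor] at hf hg ⊢
  intro n
  have := hf n
  have := hg n
  exact isIso_mapKb_tensorKbHom (vertexFunctor R n) f g

lemma tensorKb_inverts [IsTensorRelations R] :
    MorphismProperty.IsInvertedBy₂ (acyclicKb (RelRep R)).trW (acyclicKb (RelRep R)).trW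
      (tensorKb (RelRep R) ⋙ (Functor.whiskeringRight _ _ _).obj (Db.Q (RelRep R))) := by
  rintro ⟨K, L⟩ ⟨K', L'⟩ ⟨f, g⟩ ⟨hf, hg⟩
  have h := Localization.inverts (Db.Q (RelRep R)) (acyclicKb (RelRep R)).trW _
    (trW_tensorKbHom R f g hf hg)
  have e : (Functor.uncurry.obj (tensorKb (RelRep R) ⋙
      (Functor.whiskeringRight _ _ _).obj (Db.Q (RelRep R)))).map
        (show (K, L) ⟶ (K', L') from (f, g)) = (Db.Q (RelRep R)).map (tensorKbHom f g) := by
    refine Eq.trans ((Db.Q (RelRep R)).map_comp _ _).symm ?_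
    refine congrArg (Db.Q (RelRep R)).map ?_
    exact (tensorKbHom_comp _ _ _ _).symm.trans
      (by rw [Category.comp_id, Category.id_comp])
  exact e ▸ h

/-- The tensor product on the bounded derived category `D^b` of the category of representations
of a quiver with tensor relations: the bifunctor which is induced by the tensor product of
complexes. -/
def derivedTensor [IsTensorRelations R] : Db (RelRep R) ⥤ Db (RelRep R) ⥤ Db (RelRep R) :=
  Localization.lift₂ _ (tensorKb_inverts R) (Db.Q (RelRep R)) (Db.Q (RelRep R))

/-- The objects `X` of the bounded derived category whose cohomology vanishes at the
vertex `n`. -/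
def vertexIdeal (n : V) : ObjectProperty (Db (RelRep R)) :=
  fun X => ∀ i : ℤ, IsZero ((vertexFunctor R n).obj ((Db.cohomology (RelRep R) i).obj X))

end Quivers

end QuiverSpc

end

open CategoryTheory Limits MonoidalCategory Pretriangulated
open scoped ZeroObject

noncomputable section

namespace QuiverSpc

/-! ### Subcategories of the bounded derived category -/

section DerivedSubcategories

variable {C : Type*} [Category C] [Abelian C]

/-! Write `F_n` for the functor sending a representation to its space at the vertex `n`. It is exact
and monoidal, and `P_n` is the kernel of the induced functor to complexes of vector spaces. Over a
field a tensor product of bounded complexes is acyclic exactly when one factor is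
(`acyclicKb_tensorKbObj_iff`); since `F_n` respects tensor products, `P_n` is a tensor ideal with
the prime property (`vertexIdeal_tensor_iff`). The `F_n` are jointly conservative, so an object
lying in every `P_n` is zero.

Every prime `P` contains some `P_n`: otherwise choose `X_n` in `P_n` but not in `P` for each `n`.
The tensor product of these finitely many objects lies in every `P_n`, hence is zero and lies in
`P`, against primeness (`exists_vertexIdeal_le`).

If `P_n ≤ P` with `P` proper, then `P = P_n` (`eq_vertexIdeal_of_le`). Let `S_n` be the simple
representation at `n` and `U_n` the subrepresentation of the unit supported on the vertices
reachable from `n`. In the roof `1 ← U_n → S_n` both maps are isomorphisms at `n`, so their cones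
lie in `P_n`, and `X ∈ P` if and only if `S_n ⊗ X ∈ P` (`prop_iff_prop_simpleRep_tensor`). If `X` is
in `P` but not in `P_n`, then `S_n ⊗ X` has a shift of `S_n` as a direct summand, because
representations supported at `n` are just vector spaces when there are no oriented cycles. Thus `S_n
∈ P`, so `S_n ⊗ Y ∈ P` and hence `Y ∈ P` for every `Y`, a contradiction.

Finally `S_n` lies in `P_m` exactly when `m ≠ n`. This makes each `P_n` proper, separates the `P_n`,
and gives `Z({S_n}) = {P_n}`; a finite space with closed points is discrete. -/

lemma Db.exists_iso (X : Db C) : ∃ K : Kb C, Nonempty ((Db.Q C).obj K ≅ X) :=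
  have := Localization.essSurj (Db.Q C) (acyclicKb C).trW
  ⟨_, ⟨(Db.Q C).objObjPreimageIso X⟩⟩

/-- Objects and distinguished triangles of the Verdier quotient all come, up to isomorphism, from
`K^b(C)`, so the closure axioms can be checked there. -/
lemma Db.isTriangulated_of_inverseImage (P : ObjectProperty (Db C)) [P.IsClosedUnderIsomorphisms]
    (h : (P.inverseImage (Db.Q C)).IsTriangulated) : P.IsTriangulated where
  exists_zero := by
    obtain ⟨Z, hZ, hPZ⟩ := h.toContainsZero.exists_zero
    exact ⟨_, (Db.Q C).map_isZero hZ, hPZ⟩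
  isStableUnderShiftBy a :=
    { le_shift := by
        intro X hX
        obtain ⟨K, ⟨e⟩⟩ := Db.exists_iso X
        have h₁ : P.inverseImage (Db.Q C) K := P.prop_of_iso e.symm hX
        have h₂ : P ((Db.Q C).obj (K⟦a⟧)) := (P.inverseImage (Db.Q C)).le_shift a _ h₁
        exact P.prop_of_iso (((Db.Q C).commShiftIso a).app K ≪≫ (shiftFunctor _ a).mapIso e) h₂ }
  ext₂' T hT h₁ h₃ := by
    obtain ⟨T', e, hT'⟩ := hT
    have h₂ : P.inverseImage (Db.Q C) T'.obj₂ :=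
      (P.inverseImage (Db.Q C)).ext_of_isTriangulatedClosed₂ T' hT'
        (P.prop_of_iso (Triangle.π₁.mapIso e) h₁) (P.prop_of_iso (Triangle.π₃.mapIso e) h₃)
    exact P.le_isoClosure _ (P.prop_of_iso (Triangle.π₂.mapIso e).symm h₂)

lemma acyclicKb_iff (K : Kb C) : acyclicKb C K ↔ ∀ i : ℤ, IsZero (K.obj.as.homology i) := by
  refine (HomotopyCategory.mem_subcategoryAcyclic_iff K.obj).trans (forall_congr' (fun i => ?_))
  exact ((HomotopyCategory.homologyFunctorFactors C (.up ℤ) i).app K.obj.as).isZero_iff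

lemma isZero_Q_obj (K : Kb C) (h : acyclicKb C K) : IsZero ((Db.Q C).obj K) := by
  -- The contractible triangle on `K` shows that `K ⟶ 0` has the acyclic fibre `K`, so it becomes
  -- invertible in `D^b(C)`.
  have h₁ : (acyclicKb C).trW (0 : K ⟶ 0) :=
    (ObjectProperty.trW_iff' _ _).2 ⟨K, 𝟙 K, 0, contractible_distinguished K, h⟩
  have := Localization.inverts (Db.Q C) _ _ h₁
  exact ((Db.Q C).map_isZero (isZero_zero (Kb C))).of_iso (asIso ((Db.Q C).map (0 : K ⟶ 0)))

/-- If the cone of a morphism belongs to a triangulated subcategory, then its source does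
if and only if its target does. -/
lemma prop_iff_of_trW {T : Type*} [Category T] [Preadditive T] [HasZeroObject T] [HasShift T ℤ]
    [∀ n : ℤ, (shiftFunctor T n).Additive] [Pretriangulated T] {P P' : ObjectProperty T}
    [P.IsTriangulated] [P.IsClosedUnderIsomorphisms] (hP : P' ≤ P) {X Y : T} (f : X ⟶ Y)
    (hf : P'.trW f) : P X ↔ P Y := by
  obtain ⟨Z, g, h, mem, hZ⟩ := (P'.trW_iff f).1 hf
  exact ⟨fun hX => P.ext_of_isTriangulatedClosed₂ _ mem hX (hP _ hZ),
    fun hY => P.ext_of_isTriangulatedClosed₁ _ mem hY (hP _ hZ)⟩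

end DerivedSubcategories

/-! ### Vanishing at a vertex, tested on complexes of vector spaces. -/

section VertexIdeals

universe u v w
variable {k : Type u} [Field k] {V : Type v} [Quiver.{w} V] (R : Relations k V)

/-- Exactness of the vertex functor lets it commute with homology. Questions about `P_n` thereby
become questions about acyclic complexes of vector spaces. -/
lemma vertexIdeal_Q_obj_iff (n : V) (K : Kb (RelRep R)) :
    vertexIdeal R n ((Db.Q _).obj K) ↔
      acyclicKb (ModuleCat.{u} k) ((mapKb (vertexFunctor R n)).obj K) := by
  rw [acyclicKb_iff]
  refine forall_congr' (fun i => Iso.isZero_iff ?_)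
  refine (vertexFunctor R n).mapIso ((Localization.fac
    ((boundedHomotopy _).ι ⋙ HomotopyCategory.homologyFunctor _ (.up ℤ) i) _ (Db.Q _)).app K ≪≫
      (HomotopyCategory.homologyFunctorFactors _ (.up ℤ) i).app K.obj.as) ≪≫ ?_
  exact ((K.obj.as.sc i).mapHomologyIso (vertexFunctor R n)).symm

instance (n : V) : (vertexIdeal R n).IsClosedUnderIsomorphisms where
  of_iso e h i := (h i).of_iso
    ((vertexFunctor R n).mapIso ((Db.cohomology (RelRep R) i).mapIso e.symm))

instance (n : V) : (vertexIdeal R n).IsStableUnderRetracts where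
  of_retract r h i := by
    let r' := (r.map (Db.cohomology (RelRep R) i)).map (vertexFunctor R n)
    rw [IsZero.iff_id_eq_zero, ← r'.retract, (h i).eq_of_tgt r'.i 0, zero_comp]

instance (n : V) : (vertexIdeal R n).IsTriangulated := by
  apply Db.isTriangulated_of_inverseImage
  have : (vertexIdeal R n).inverseImage (Db.Q _) =
      (acyclicKb (ModuleCat.{u} k)).inverseImage (mapKb (vertexFunctor R n)) := by
    ext K
    exact vertexIdeal_Q_obj_iff R n K
  rw [this]
  -- Up to unfolding, this is the preimage of the acyclic complexes under a composite of
  -- triangulated functors into the full homotopy category.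
  exact inferInstanceAs ((HomotopyCategory.subcategoryAcyclic _).inverseImage
    ((boundedHomotopy _).ι ⋙ (vertexFunctor R n).mapHomotopyCategory (.up ℤ))).IsTriangulated

/-- The cone of `f` becomes zero after evaluation at `n`, hence belongs to `P_n`. Any ideal
containing `P_n` therefore cannot distinguish the source of `f` from its target. -/
lemma trW_vertexIdeal {n : V} {K L : Kb (RelRep R)} (f : K ⟶ L)
    (hf : IsIso ((mapKb (vertexFunctor R n)).map f)) :
    (vertexIdeal R n).trW ((Db.Q _).map f) := by
  obtain ⟨M, g, h, mem⟩ := Pretriangulated.distinguished_cocone_triangle f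
  refine (ObjectProperty.trW_iff _ _).2
    ⟨_, _, _, (Db.Q (RelRep R)).map_distinguished _ mem, ?_⟩
  have h₁ : vertexIdeal R n ((Db.Q _).obj M) := by
    rw [vertexIdeal_Q_obj_iff]
    have h₂ : IsIso (((boundedHomotopy _).ι ⋙
      (vertexFunctor R n).mapHomotopyCategory (.up ℤ)).map f) :=
      inferInstanceAs (IsIso ((boundedHomotopy _).ι.map ((mapKb (vertexFunctor R n)).map f)))
    have h₃ := (Triangle.isZero₃_iff_isIso₁ _ (((boundedHomotopy _).ι ⋙
      (vertexFunctor R n).mapHomotopyCategory (.up ℤ)).map_distinguished _ mem)).2 h₂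
    exact (HomotopyCategory.subcategoryAcyclic _).prop_of_isZero h₃
  exact h₁

/-- The vertex functors are exact and jointly reflect isomorphisms, so a representing complex has
zero homology and dies in `D^b`. -/
lemma isZero_of_vertexIdeal (X : Db (RelRep R)) (hX : ∀ n, vertexIdeal R n X) : IsZero X := by
  obtain ⟨K, ⟨e⟩⟩ := Db.exists_iso X
  refine IsZero.of_iso (isZero_Q_obj K ?_) e.symm
  rw [acyclicKb_iff]
  intro i
  have h (n : V) : IsZero ((vertexFunctor R n).obj (K.obj.as.homology i)) :=
    IsZero.of_iso ((acyclicKb_iff _).1 ((vertexIdeal_Q_obj_iff R n K).1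
      ((vertexIdeal R n).prop_of_iso e.symm (hX n))) i)
        ((K.obj.as.sc i).mapHomologyIso (vertexFunctor R n)).symm
  have := isIso_of_vertexFunctor R (0 : K.obj.as.homology i ⟶ 0) (fun n =>
    (h n).isIso ((vertexFunctor R n).map_isZero (isZero_zero _)) _)
  exact (isZero_zero _).of_iso (asIso (0 : K.obj.as.homology i ⟶ 0))

end VertexIdeals

/-! ### Tensor products of complexes -/

section TensorComplexes

open HomologicalComplex

variable {C : Type*} [Category C] [Abelian C]

/-- A split cycle which is annihilated by a retraction vanishing on boundaries splits off a
complex concentrated in a single degree. -/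
lemma nonempty_retract_single (K : CochainComplex C ℤ) (i : ℤ) {M : C} (a : M ⟶ K.X i)
    (b : K.X i ⟶ M) (ha : a ≫ K.d i (i + 1) = 0) (hb : K.d (i - 1) i ≫ b = 0)
    (hab : a ≫ b = 𝟙 M) : Nonempty (Retract ((single C (.up ℤ) i).obj M) K) :=
  ⟨{ i := mkHomFromSingle a (by rintro _ rfl; exact ha)
     r := mkHomToSingle b (by
      intro j hj
      obtain rfl : j = i - 1 := by
        simp at hj
        lia
      exact hb)
     retract := from_single_hom_ext (by simp [reassoc_of% hab]) }⟩

lemma isZero_homology_of_retract {K L : CochainComplex C ℤ} (r : Retract K L) (i : ℤ)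
    (h : IsZero (L.homology i)) : IsZero (K.homology i) := by
  rw [IsZero.iff_id_eq_zero, ← homologyMap_id, ← r.retract, homologyMap_comp,
    h.eq_of_tgt (homologyMap r.i i) 0, zero_comp]

variable [MonoidalCategory C] [MonoidalPreadditive C]

/-- The tensor product of retracts of complexes. -/
def tensorRetract {K K' L L' : CochainComplex C ℤ} [HasTensor K L] [HasTensor K' L']
    (r : Retract K K') (s : Retract L L') : Retract (tensorObj K L) (tensorObj K' L') where
  i := tensorHom r.i s.i
  r := tensorHom r.r s.r
  retract := by
    have h₁ (i : ℤ) : r.i.f i ≫ r.r.f i = 𝟙 _ := congr_hom r.retract i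
    have h₂ (i : ℤ) : s.i.f i ≫ s.r.f i = 𝟙 _ := congr_hom s.retract i
    ext n i j hij
    simp only [comp_f, ι_mapBifunctorMap_assoc, curriedTensor_map_app, curriedTensor_obj_map,
      ι_mapBifunctorMap, id_f, Category.comp_id]
    rw [← whisker_exchange_assoc, ← comp_whiskerRight_assoc, h₁, id_whiskerRight,
      Category.id_comp, ← MonoidalCategory.whiskerLeft_comp_assoc, h₂,
      MonoidalCategory.whiskerLeft_id, Category.id_comp]

lemma isZero_tensorObj_X (K L : CochainComplex C ℤ) [HasTensor K L] (n : ℤ)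
    (h : ∀ i j : ℤ, i + j = n → IsZero (K.X i) ∨ IsZero (L.X j)) :
    IsZero ((tensorObj K L).X n) := by
  rw [IsZero.iff_id_eq_zero]
  refine mapBifunctor.hom_ext (fun i j hij => IsZero.eq_of_src ?_ _ _)
  rcases h i j hij with h | h
  · exact Functor.map_isZero (tensorRight (L.X j)) h
  · exact Functor.map_isZero (tensorLeft (K.X i)) h

/-- Since `K` lives in degree `i` only, the total complex in degree `n` has a single possibly
nonzero summand, the one indexed by `(i, j)`. -/
lemma isIso_ιTensorObj (K L : CochainComplex C ℤ) [HasTensor K L] (i : ℤ)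
    (hK : ∀ p, p ≠ i → IsZero (K.X p)) (j n : ℤ) (h : i + j = n) :
    IsIso (ιTensorObj K L i j n h) := by
  let ψ : (tensorObj K L).X n ⟶ K.X i ⊗ L.X j :=
    -- The projection to that summand: `p = i` forces `q = j`, and all other summands are sent to
    -- zero.
    mapBifunctorDesc (fun p q (h' : p + q = n) =>
      if hp : p = i then
        ((K.XIsoOfEq hp).hom ⊗ₘ (L.XIsoOfEq (show q = j by lia)).hom) else 0)
  have hψ : ιTensorObj K L i j n h ≫ ψ = 𝟙 _ := by
    refine (ι_mapBifunctorDesc _ _ _ _).trans ?_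
    simp
  refine ⟨ψ, hψ, mapBifunctor.hom_ext (fun p q h' => ?_)⟩
  by_cases hp : p = i
  · subst hp
    obtain rfl : q = j := by
      have : p + q = n := h'
      lia
    rw [reassoc_of% hψ, Category.comp_id]
  · exact IsZero.eq_of_src (Functor.map_isZero (tensorRight (L.X q)) (hK p hp)) _ _

/-- The total complex is concentrated in degree `i + j`, where it is `M ⊗ N`. Exactness in that
degree, between zero objects, would force `M ⊗ N` to vanish. -/
lemma not_isZero_homology_tensorObj_single {M N : C} (h : ¬ IsZero (M ⊗ N)) (i j : ℤ)
    [HasTensor ((single C (.up ℤ) i).obj M) ((single C (.up ℤ) j).obj N)] :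
    ¬ IsZero ((tensorObj ((single C (.up ℤ) i).obj M) ((single C (.up ℤ) j).obj N)).homology
      (i + j)) := by
  intro H
  have hz (n : ℤ) (hn : n ≠ i + j) :
      IsZero ((tensorObj ((single C (.up ℤ) i).obj M) ((single C (.up ℤ) j).obj N)).X n) := by
    refine isZero_tensorObj_X _ _ _ (fun p q hpq => ?_)
    by_cases hp : p = i
    · exact Or.inr (isZero_single_obj_X _ _ _ _ (by lia))
    · exact Or.inl (isZero_single_obj_X _ _ _ _ hp)
  rw [← exactAt_iff_isZero_homology, exactAt_iff' _ (i + j - 1) (i + j) (i + j + 1)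
    (by simp) (by simp)] at H
  have h₂ : IsZero ((tensorObj ((single C (.up ℤ) i).obj M)
      ((single C (.up ℤ) j).obj N)).X (i + j)) :=
    H.isZero_X₂ ((hz _ (by lia)).eq_of_src _ _) ((hz _ (by lia)).eq_of_tgt _ _)
  have := isIso_ιTensorObj ((single C (.up ℤ) i).obj M) ((single C (.up ℤ) j).obj N) i
    (fun p hp => isZero_single_obj_X _ _ _ _ hp) j _ rfl
  exact h (IsZero.of_iso h₂ (((singleObjXSelf (.up ℤ) i M).symm ⊗ᵢ
    (singleObjXSelf (.up ℤ) j N).symm) ≪≫ asIso (ιTensorObj _ _ i j _ rfl)))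

instance (M : C) : (tensorLeft M).Additive where
  map_add {_ _ f g} := MonoidalPreadditive.whiskerLeft_add f g

/-- The tensor product with a complex concentrated in degree `0`. -/
lemma nonempty_tensorObj_single_zero_iso (M : C) (L : CochainComplex C ℤ)
    [HasTensor ((single C (.up ℤ) 0).obj M) L] :
    Nonempty (((tensorLeft M).mapHomologicalComplex (.up ℤ)).obj L ≅
      tensorObj ((single C (.up ℤ) 0).obj M) L) := by
  let f (n : ℤ) : M ⊗ L.X n ≅ (tensorObj ((single C (.up ℤ) 0).obj M) L).X n :=
    whiskerRightIso (singleObjXSelf (.up ℤ) 0 M).symm (L.X n) ≪≫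
      (have := isIso_ιTensorObj ((single C (.up ℤ) 0).obj M) L 0
        (fun p hp => isZero_single_obj_X _ _ _ _ hp) n n (zero_add n)
      asIso (ιTensorObj ((single C (.up ℤ) 0).obj M) L 0 n n (zero_add n)))
  refine ⟨Hom.isoOfComponents f (fun i j hij => ?_)⟩
  have hij' : 0 + (i + 1) = j := by
    rw [zero_add]
    exact hij
  -- The horizontal differential vanishes because it comes from a complex in a single degree. The
  -- vertical one carries the sign of degree `0`, which is trivial, so it is `M ◁ L.d`.
  have h₁ : mapBifunctor.d₁ ((single C (.up ℤ) 0).obj M) L (curriedTensor C) (.up ℤ) 0 i j = 0 := by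
    rw [mapBifunctor.d₁_eq _ _ _ _ (show (ComplexShape.up ℤ).Rel 0 1 from rfl) _ _
      (show (1 : ℤ) + i = j by lia), single_obj_d, Functor.map_zero, zero_app, zero_comp, smul_zero]
  have h₂ : ((singleObjXSelf (.up ℤ) 0 M).inv ▷ L.X i ≫ ιTensorObj _ L 0 i i (zero_add i)) ≫
      (tensorObj ((single C (.up ℤ) 0).obj M) L).d i j =
      M ◁ L.d i j ≫ (singleObjXSelf (.up ℤ) 0 M).inv ▷ L.X j ≫
        ιTensorObj _ L 0 j j (zero_add j) := by
    rw [mapBifunctor.d_eq, Preadditive.comp_add, Category.assoc, Category.assoc,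
      mapBifunctor.ι_D₁, mapBifunctor.ι_D₂, h₁, comp_zero, zero_add,
      mapBifunctor.d₂_eq _ _ _ _ _ hij _ (show (0 : ℤ) + j = j by lia)]
    simp [whisker_exchange_assoc]
  exact h₂

end TensorComplexes

section SingleKb

variable {C : Type*} [Category C] [Abelian C]

/-- The complex with a single object in a given degree, as an object of `K^b(C)`. -/
def Kb.single (i : ℤ) (M : C) : Kb C :=
  ⟨(HomotopyCategory.quotient C (.up ℤ)).obj ((HomologicalComplex.single C (.up ℤ) i).obj M),
    i, i,
    inferInstanceAs (CochainComplex.IsStrictlyGE ((CochainComplex.singleFunctor C i).obj M) i),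
    inferInstanceAs (CochainComplex.IsStrictlyLE ((CochainComplex.singleFunctor C i).obj M) i)⟩

end SingleKb

/-! ### Tensor products of bounded complexes over a field. -/

section VectorSpaces

universe u
variable {k : Type u} [Field k]

/-- Choose a cycle `x` that is not a boundary, and a linear form `φ` that kills the boundaries but
not `x`. Rescaling `x` by `(φ x)⁻¹` makes the composite the identity, so a copy of `k` in degree `i`
splits off. -/
lemma exists_split_cycle (K : CochainComplex (ModuleCat.{u} k) ℤ) (i : ℤ)
    (h : ¬ IsZero (K.homology i)) :
    ∃ (a : 𝟙_ (ModuleCat.{u} k) ⟶ K.X i) (b : K.X i ⟶ 𝟙_ (ModuleCat.{u} k)),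
      a ≫ K.d i (i + 1) = 0 ∧ K.d (i - 1) i ≫ b = 0 ∧ a ≫ b = 𝟙 _ := by
  rw [← HomologicalComplex.exactAt_iff_isZero_homology,
    K.exactAt_iff' (i - 1) i (i + 1) (by simp) (by simp), ShortComplex.moduleCat_exact_iff] at h
  push Not at h
  obtain ⟨x : K.X i, hx, hx'⟩ := h
  obtain ⟨φ, hφ, hφ'⟩ := Submodule.exists_le_ker_of_notMem
    (p := LinearMap.range (K.d (i - 1) i).hom) (v := x) (by rintro ⟨y, hy⟩; exact hx' y hy)
  have hx₁ : (K.d i (i + 1)).hom x = 0 := hx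
  clear hx hx'
  refine ⟨ModuleCat.ofHom (LinearMap.toSpanSingleton k _ ((φ x)⁻¹ • x)), ModuleCat.ofHom φ,
    ?_, ?_, ?_⟩
  · refine ModuleCat.hom_ext (LinearMap.ext fun (c : k) => ?_)
    change (K.d i (i + 1)).hom (c • (φ x)⁻¹ • x) = 0
    rw [map_smul, map_smul, hx₁, smul_zero, smul_zero]
  · ext y
    exact hφ' ⟨y, rfl⟩
  · refine ModuleCat.hom_ext (LinearMap.ext fun (c : k) => ?_)
    change φ (c • (φ x)⁻¹ • x) = c
    simp [hφ]

lemma not_isZero_unit_tensor_unit :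
    ¬ IsZero (𝟙_ (ModuleCat.{u} k) ⊗ 𝟙_ (ModuleCat.{u} k)) := by
  intro h
  have h' := ModuleCat.subsingleton_of_isZero (h.of_iso (λ_ (𝟙_ (ModuleCat.{u} k))).symm)
  exact not_subsingleton k h'

lemma tensorKbHom_zero_left {C : Type*} [Category C] [Abelian C] [MonoidalCategory C]
    [MonoidalPreadditive C] {K K' L L' : Kb C} (g : L ⟶ L') :
    tensorKbHom (0 : K ⟶ K') g = 0 := by
  rw [tensorKbHom_eq (0 : K ⟶ K') g 0 (Quot.out g.hom) (CategoryTheory.Functor.map_zero _ _ _)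
    (HomotopyCategory.quotient_map_out g.hom)]
  have h : HomologicalComplex.tensorHom (0 : K.obj.as ⟶ K'.obj.as) (Quot.out g.hom) = 0 := by
    ext n i j hij
    simp
  exact congrArg ObjectProperty.homMk
    ((congrArg (HomotopyCategory.quotient C (.up ℤ)).map h).trans
      (CategoryTheory.Functor.map_zero _ _ _))

lemma tensorKbHom_zero_right {C : Type*} [Category C] [Abelian C] [MonoidalCategory C]
    [MonoidalPreadditive C] {K K' L L' : Kb C} (f : K ⟶ K') :
    tensorKbHom f (0 : L ⟶ L') = 0 := by
  rw [tensorKbHom_eq f (0 : L ⟶ L') (Quot.out f.hom) 0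
    (HomotopyCategory.quotient_map_out f.hom) (CategoryTheory.Functor.map_zero _ _ _)]
  have h : HomologicalComplex.tensorHom (Quot.out f.hom) (0 : L.obj.as ⟶ L'.obj.as) = 0 := by
    ext n i j hij
    simp
  exact congrArg ObjectProperty.homMk
    ((congrArg (HomotopyCategory.quotient C (.up ℤ)).map h).trans
      (CategoryTheory.Functor.map_zero _ _ _))

/-- A bounded acyclic complex over a field is contractible. As an equation between morphisms,
acyclicity is visibly preserved by tensoring with any complex. -/
lemma acyclicKb_moduleCat_iff (K : Kb (ModuleCat.{u} k)) : acyclicKb _ K ↔ 𝟙 K = 0 := by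
  refine ⟨fun hK => ?_, fun hK => (HomotopyCategory.subcategoryAcyclic _).prop_of_isZero
        ((boundedHomotopy _).ι.map_isZero ((IsZero.iff_id_eq_zero K).2 hK))⟩
  have : IsIso (0 : K ⟶ 0) := isIso_of_quasiIso_moduleCat _ ((acyclicKb_trW_iff _ _).1
    ((ObjectProperty.trW_iff' _ _).2 ⟨K, 𝟙 K, 0, contractible_distinguished K, hK⟩))
  rw [← IsIso.hom_inv_id (0 : K ⟶ 0), zero_comp]

/-- This is the part of the Künneth theorem that is needed. If neither factor is acyclic, copies of
`k` in degrees `i` and `j` split off the factors, so `k ⊗ k` in degree `i + j` splits off the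
product. Conversely, a null-homotopic identity on one factor gives one on the product. -/
lemma acyclicKb_tensorKbObj_iff (K L : Kb (ModuleCat.{u} k)) :
    acyclicKb _ (tensorKbObj K L) ↔ acyclicKb _ K ∨ acyclicKb _ L := by
  constructor
  · intro h
    by_contra! hn
    obtain ⟨hK, hL⟩ := hn
    simp only [acyclicKb_iff, not_forall] at hK hL
    obtain ⟨i, hi⟩ := hK
    obtain ⟨j, hj⟩ := hL
    obtain ⟨a, b, ha, hb, hab⟩ := exists_split_cycle _ _ hi
    obtain ⟨a', b', ha', hb', hab'⟩ := exists_split_cycle _ _ hj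
    obtain ⟨r⟩ := nonempty_retract_single _ _ a b ha hb hab
    obtain ⟨s⟩ := nonempty_retract_single _ _ a' b' ha' hb' hab'
    have := hasTensor_Kb (Kb.single i (𝟙_ (ModuleCat.{u} k))) (Kb.single j (𝟙_ _))
    exact not_isZero_homology_tensorObj_single not_isZero_unit_tensor_unit i j
      (isZero_homology_of_retract (tensorRetract r s) (i + j) ((acyclicKb_iff _).1 h _))
  · simp only [acyclicKb_moduleCat_iff]
    rintro (h | h)
    · rw [← tensorKbHom_id, h, tensorKbHom_zero_left]
    · rw [← tensorKbHom_id, h, tensorKbHom_zero_right]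

end VectorSpaces

/-! ### The prime ideals attached to the vertices -/

section VertexPrimes

universe u v w
variable {k : Type u} [Field k] {V : Type v} [Quiver.{w} V] (R : Relations k V)
  [IsTensorRelations R]

/-- The tensor product on `D^b` is computed by the tensor product of complexes. -/
def derivedTensorIso (K L : Kb (RelRep R)) :
    ((derivedTensor R).obj ((Db.Q _).obj K)).obj ((Db.Q _).obj L) ≅
      (Db.Q _).obj (tensorKbObj K L) :=
  letI : Localization.Lifting₂ (Db.Q (RelRep R)) (Db.Q (RelRep R)) (acyclicKb (RelRep R)).trW
      (acyclicKb (RelRep R)).trW (tensorKb (RelRep R) ⋙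
        (Functor.whiskeringRight _ _ _).obj (Db.Q (RelRep R))) (derivedTensor R) :=
    inferInstanceAs (Localization.Lifting₂ _ _ _ _ _
      (Localization.lift₂ _ (tensorKb_inverts R) (Db.Q (RelRep R)) (Db.Q (RelRep R))))
  ((Localization.Lifting₂.iso (Db.Q (RelRep R)) (Db.Q (RelRep R)) (acyclicKb (RelRep R)).trW
    (acyclicKb (RelRep R)).trW (tensorKb (RelRep R) ⋙
      (Functor.whiskeringRight _ _ _).obj (Db.Q (RelRep R))) (derivedTensor R)).app K).app L

/-- Evaluation at `n` commutes with the total tensor product through `tensorComparison`, which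
reduces the claim to vector spaces. One direction gives the ideal property, the other primeness. -/
lemma vertexIdeal_tensor_iff (n : V) (X Y : Db (RelRep R)) :
    vertexIdeal R n (((derivedTensor R).obj X).obj Y) ↔
      vertexIdeal R n X ∨ vertexIdeal R n Y := by
  obtain ⟨K, ⟨e⟩⟩ := Db.exists_iso X
  obtain ⟨L, ⟨e'⟩⟩ := Db.exists_iso Y
  let ε : ((derivedTensor R).obj X).obj Y ≅ (Db.Q _).obj (tensorKbObj K L) :=
    ((derivedTensor R).obj X).mapIso e'.symm ≪≫
      ((derivedTensor R).mapIso e.symm).app _ ≪≫ derivedTensorIso R K L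
  rw [(vertexIdeal R n).prop_iff_of_iso ε, ← (vertexIdeal R n).prop_iff_of_iso e,
    ← (vertexIdeal R n).prop_iff_of_iso e', vertexIdeal_Q_obj_iff, vertexIdeal_Q_obj_iff,
    vertexIdeal_Q_obj_iff, ← acyclicKb_tensorKbObj_iff, acyclicKb_iff, acyclicKb_iff]
  have := isIso_tensorComparison (vertexFunctor R n) K L
  exact forall_congr' (fun i => ((HomologicalComplex.homologyFunctor _ _ i).mapIso
    (asIso (tensorComparison (vertexFunctor R n) K L))).symm.isZero_iff)

lemma isTensorIdeal_vertexIdeal (n : V) : IsTensorIdeal (derivedTensor R) (vertexIdeal R n) where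
  triangulated := inferInstance
  thick := inferInstance
  tensor_mem X Y hX := (vertexIdeal_tensor_iff R n X Y).2 (Or.inl hX)

/-- Every prime ideal contains one of the ideals attached to the vertices. -/
lemma exists_vertexIdeal_le [Finite V] {P : ObjectProperty (Db (RelRep R))}
    (hP : IsPrimeTensorIdeal (derivedTensor R) P) : ∃ n, vertexIdeal R n ≤ P := by
  by_contra! h
  choose X hX hX' using h
  have := Fintype.ofFinite V
  -- Tensor the chosen objects together one vertex at a time; primeness keeps the product outside
  -- `P`. The induction starts from an arbitrary object outside `P` in place of the unit.
  have key (s : Finset V) : ∃ Y, ¬ P Y ∧ ∀ n ∈ s, vertexIdeal R n Y := by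
    classical
    induction s using Finset.induction_on with
    | empty => exact hP.proper.imp (fun Y hY => ⟨hY, by simp⟩)
    | insert n s _ ih =>
      obtain ⟨Y, hY, hY'⟩ := ih
      refine ⟨((derivedTensor R).obj (X n)).obj Y,
        fun h => (hP.mem_or_mem _ _ h).elim (hX' n) hY, fun m hm => ?_⟩
      rw [vertexIdeal_tensor_iff]
      rcases Finset.mem_insert.1 hm with rfl | hm
      · exact Or.inl (hX m)
      · exact Or.inr (hY' m hm)
  obtain ⟨Y, hY, hY'⟩ := key Finset.univ
  have := hP.triangulated
  have := hP.thick
  -- For the set of all vertices the product is zero, yet it lies outside `P`.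
  exact hY (P.prop_of_isZero (isZero_of_vertexIdeal R Y (fun n => hY' n (Finset.mem_univ n))))

end VertexPrimes

/-! ### Thin representations -/

section Thin

universe u v w
variable (k : Type u) [Field k] {V : Type v} [Quiver.{w} V]

/-- The line `k` if `p` holds, and zero otherwise. -/
def lineIf (p : Prop) : Submodule k k where
  carrier := { x | ¬ p → x = 0 }
  add_mem' hx hy h := by rw [hx h, hy h, add_zero]
  zero_mem' _ := rfl
  smul_mem' c x hx h := by rw [hx h, smul_zero]

open Classical in
/-- The identity of `k` restricted to the lines attached to two propositions, and
zero if one of these does not hold. -/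
def lineIfMap (p q : Prop) : lineIf k p →ₗ[k] lineIf k q :=
  LinearMap.codRestrict _ (if q then (lineIf k p).subtype else 0) (fun x h => by simp [h])

lemma lineIfMap_apply_of_pos {p q : Prop} (hq : q) (x : lineIf k p) :
    (lineIfMap k p q x : k) = x := by
  simp [lineIfMap, hq]

lemma lineIf_eq_zero {p : Prop} (hp : ¬ p) (x : lineIf k p) : x = 0 :=
  Subtype.ext (x.2 hp)

lemma lineIfMap_self (p : Prop) : lineIfMap k p p = LinearMap.id := by
  ext x
  by_cases hp : p
  · exact lineIfMap_apply_of_pos k hp x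
  · simp [lineIf_eq_zero k hp x]

/-- The composite could differ from the direct map only if `p` and `r` hold while `q` fails. This is
why the support of a thin representation must be convex. -/
lemma lineIfMap_comp {p q r : Prop} (h : p → r → q) :
    lineIfMap k q r ∘ₗ lineIfMap k p q = lineIfMap k p r := by
  ext x
  by_cases hr : r
  · by_cases hp : p
    · simp [lineIfMap_apply_of_pos k hr, lineIfMap_apply_of_pos k (h hp hr)]
    · simp [lineIf_eq_zero k hp x]
  · exact congrArg Subtype.val ((lineIf_eq_zero k hr _).trans (lineIf_eq_zero k hr _).symm)

/-- The thin representation with support in a convex set of vertices. -/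
def thinRep (B : V → Prop) (hB : ∀ a b c, Quiver.Path a b → Quiver.Path b c → B a → B c → B b) :
    QuiverRep k V where
  obj a := FGModuleCat.of k (lineIf k (B a))
  map {a b} _ := FGModuleCat.ofHom (lineIfMap k (B a) (B b))
  map_id a := by
    rw [lineIfMap_self]
    rfl
  map_comp {a b c} f g := by
    rw [← lineIfMap_comp k (hB a b c f g)]
    rfl

variable {k} in
/-- The canonical morphism between thin representations. -/
def thinRepMap {B B' : V → Prop} (hB) (hB')
    (h : ∀ a b, Quiver.Path a b → B a → B' b → (B' a ∧ B b)) :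
    thinRep k B hB ⟶ thinRep k B' hB' where
  app a := FGModuleCat.ofHom (lineIfMap k (B a) (B' a))
  naturality a b f := by
    change FGModuleCat.ofHom (lineIfMap k (B b) (B' b) ∘ₗ lineIfMap k (B a) (B b)) =
      FGModuleCat.ofHom (lineIfMap k (B' a) (B' b) ∘ₗ lineIfMap k (B a) (B' a))
    -- Both sides of the square equal the direct map from the line at `B a` to the line at `B' b`;
    -- the two parts of `h` supply the intermediate conditions.
    rw [lineIfMap_comp, lineIfMap_comp]
    · exact fun ha hb => (h a b f ha hb).1
    · exact fun ha hb => (h a b f ha hb).2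

variable {k} in
/-- The inclusion of the thin representation attached to a set of vertices which is closed under
successors into the unit representation. -/
def thinRepToUnit {B : V → Prop} (hB) (h : ∀ a b, Quiver.Path a b → B a → B b) :
    thinRep k B hB ⟶ 𝟙_ (QuiverRep k V) where
  app a := FGModuleCat.ofHom (lineIf k (B a)).subtype
  naturality a b f := by
    ext x
    by_cases ha : B a
    · exact lineIfMap_apply_of_pos k (h a b f ha) x
    · obtain rfl := lineIf_eq_zero k ha x
      exact (map_zero (lineIf k (B b)).subtype ▸
        congrArg (lineIf k (B b)).subtype (map_zero (lineIfMap k (B a) (B b))) :)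

lemma convex_reachable (n : V) (a b c : V) (f : Quiver.Path a b) (_ : Quiver.Path b c)
    (ha : Nonempty (Quiver.Path n a)) (_ : Nonempty (Quiver.Path n c)) :
    Nonempty (Quiver.Path n b) :=
  ⟨ha.some.comp f⟩

end Thin

/-! ### The simple representation at a vertex and its roof to the unit. -/

section Simple

universe u v w
variable {k : Type u} [Field k] {V : Type v} [Quiver.{w} V] [FiniteOrdered V]

lemma FiniteOrdered.eq_of_path {a b : V} (p : Quiver.Path a b) (q : Quiver.Path b a) : a = b := by
  have h := FiniteOrdered.acyclic a (p.comp q)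
  have h' := congrArg Quiver.Path.length h
  simp at h'
  exact Quiver.Path.eq_of_length_zero p h'.1

lemma convex_singleton (n : V) (a b c : V) (f : Quiver.Path a b) (g : Quiver.Path b c)
    (ha : a = n) (hc : c = n) : b = n := by
  subst ha hc
  exact (FiniteOrdered.eq_of_path f g).symm

variable (k) in
/-- The inclusion in the unit representation of its restriction to the vertices which are
reachable from `n`. -/
def reachableToUnit (n : V) :
    thinRep k (fun a => Nonempty (Quiver.Path n a)) (convex_reachable n) ⟶ 𝟙_ (QuiverRep k V) :=
  thinRepToUnit _ (fun _ _ f h => ⟨h.some.comp f⟩)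

variable (k) in
/-- The projection of the restriction of the unit representation to the vertices which are
reachable from `n` onto the simple representation at `n`. -/
def reachableToSimple (n : V) :
    thinRep k (fun a => Nonempty (Quiver.Path n a)) (convex_reachable n) ⟶
      thinRep k (fun a => a = n) (convex_singleton n) :=
  thinRepMap _ _ (by
    -- A path from `a` to `n`, with `a` reachable from `n`, closes up to a cycle, so `a = n`. Thus
    -- no arrow leads from the discarded vertices back to `n`, and the projection is a morphism.
    rintro a _ f ⟨g⟩ rfl
    exact ⟨FiniteOrdered.eq_of_path f g, ⟨.nil⟩⟩)

instance (n : V) : Mono (reachableToUnit k n) := by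
  have (x : Paths V) : Mono ((reachableToUnit k n).app x) := by
    apply (forget₂ (FGModuleCat.{u} k) (ModuleCat.{u} k)).mono_of_mono_map
    exact (ModuleCat.mono_iff_injective _).2 (Submodule.subtype_injective _)
  exact NatTrans.mono_of_mono_app _

instance (n : V) : Epi (reachableToSimple k n) := by
  have (x : Paths V) : Epi ((reachableToSimple k n).app x) := by
    apply (forget₂ (FGModuleCat.{u} k) (ModuleCat.{u} k)).epi_of_epi_map
    refine (ModuleCat.epi_iff_surjective _).2 (fun (y : lineIf k _) => ?_)
    by_cases hx : (show V from x) = n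
    · exact ⟨(⟨y.1, fun h => (h ⟨by subst hx; exact .nil⟩).elim⟩ : lineIf k _),
        Subtype.ext (lineIfMap_apply_of_pos k hx _)⟩
    · exact ⟨(0 : lineIf k _), ((lineIf_eq_zero k hx y).trans (map_zero _).symm).symm⟩
  exact NatTrans.epi_of_epi_app _

variable (R : Relations k V) [IsTensorRelations R]

/-- The unit representation restricted to the vertices which are reachable from `n`. -/
def upperRep (n : V) : RelRep R :=
  ⟨thinRep k (fun a => Nonempty (Quiver.Path n a)) (convex_reachable n),
    -- Relations pass to subobjects, and the unit satisfies them; for the simple representation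
    -- below they pass on to a quotient.
    R.satisfiedBy.prop_of_mono (reachableToUnit k n) R.satisfiedBy.prop_unit⟩

/-- The simple representation at a vertex. -/
def simpleRep (n : V) : RelRep R :=
  ⟨thinRep k (fun a => a = n) (convex_singleton n),
    R.satisfiedBy.prop_of_epi (reachableToSimple k n) (upperRep R n).property⟩

/-- The inclusion of `upperRep` in the unit representation. -/
def upperRepToUnit (n : V) : upperRep R n ⟶ 𝟙_ (RelRep R) :=
  ObjectProperty.homMk (reachableToUnit k n)

/-- The projection from `upperRep` to the simple representation. -/
def upperRepToSimple (n : V) : upperRep R n ⟶ simpleRep R n :=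
  ObjectProperty.homMk (reachableToSimple k n)

/-- The trivial path makes `n` reachable from itself, so at `n` both legs of the roof are
isomorphisms between copies of `k`. -/
instance (n : V) : IsIso ((vertexFunctor R n).map (upperRepToUnit R n)) := by
  refine (ConcreteCategory.isIso_iff_bijective _).2 ⟨Subtype.val_injective, ?_⟩
  intro (x : k)
  exact ⟨(⟨x, fun h => (h ⟨.nil⟩).elim⟩ : lineIf k (Nonempty (Quiver.Path n n))), rfl⟩

instance (n : V) : IsIso ((vertexFunctor R n).map (upperRepToSimple R n)) := by
  refine (ConcreteCategory.isIso_iff_bijective _).2 ⟨?_, ?_⟩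
  · intro (x : lineIf k (Nonempty (Quiver.Path n n))) (y : lineIf k (Nonempty (Quiver.Path n n))) h
    exact Subtype.ext ((lineIfMap_apply_of_pos k (q := n = n) rfl x).symm.trans
      ((congrArg (Subtype.val : lineIf k (n = n) → k) h).trans
        (lineIfMap_apply_of_pos k (q := n = n) rfl y)))
  · intro (y : lineIf k (n = n))
    exact ⟨(⟨y.1, fun h => (h ⟨.nil⟩).elim⟩ : lineIf k (Nonempty (Quiver.Path n n))),
      Subtype.ext (lineIfMap_apply_of_pos k (q := n = n) rfl _)⟩

lemma isZero_vertexFunctor_simpleRep {m n : V} (h : m ≠ n) :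
    IsZero ((vertexFunctor R m).obj (simpleRep R n)) := by
  have : Subsingleton ((vertexFunctor R m).obj (simpleRep R n)) :=
    ⟨fun (x : lineIf k _) (y : lineIf k _) =>
      (lineIf_eq_zero k h x).trans (lineIf_eq_zero k h y).symm⟩
  exact ModuleCat.isZero_of_subsingleton _

lemma not_isZero_vertexFunctor_simpleRep (n : V) :
    ¬ IsZero ((vertexFunctor R n).obj (simpleRep R n)) := by
  intro h
  have : Subsingleton (lineIf k (n = n)) := ModuleCat.subsingleton_of_isZero h
  exact one_ne_zero (congrArg Subtype.val
    (Subsingleton.elim (⟨1, fun h => (h rfl).elim⟩ : lineIf k (n = n)) 0))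

end Simple

/-! ### The classification of the prime ideals -/

section SingleShift

variable {C : Type*} [Category C] [Abelian C]

/-- Functoriality of complexes concentrated in a single degree. -/
def Kb.singleMap (i : ℤ) {M N : C} (f : M ⟶ N) : Kb.single i M ⟶ Kb.single i N :=
  ObjectProperty.homMk ((HomotopyCategory.quotient C (.up ℤ)).map
    ((HomologicalComplex.single C (.up ℤ) i).map f))

lemma isIso_mapKb_map_singleMap {D : Type*} [Category D] [Abelian D] (F : C ⥤ D) [F.Additive]
    (i : ℤ) {M N : C} (f : M ⟶ N) [IsIso (F.map f)] :
    IsIso ((mapKb F).map (Kb.singleMap i f)) := by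
  let φ := (F.mapHomologicalComplex (.up ℤ)).map ((HomologicalComplex.single C (.up ℤ) i).map f)
  have (p : ℤ) : IsIso (φ.f p) := by
    by_cases hp : p = i
    · subst hp
      change IsIso (F.map (((HomologicalComplex.single C (.up ℤ) p).map f).f p))
      rw [HomologicalComplex.single_map_f_self, F.map_comp, F.map_comp]
      infer_instance
    · exact (F.map_isZero (HomologicalComplex.isZero_single_obj_X _ _ _ _ hp)).isIso
        (F.map_isZero (HomologicalComplex.isZero_single_obj_X _ _ _ _ hp)) _
  have : IsIso φ := HomologicalComplex.Hom.isIso_of_components _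
  have : IsIso ((boundedHomotopy D).ι.map ((mapKb F).map (Kb.singleMap i f))) :=
    inferInstanceAs (IsIso ((HomotopyCategory.quotient D (.up ℤ)).map φ))
  exact isIso_of_reflects_iso _ (boundedHomotopy D).ι

/-- The shift of a complex concentrated in a single degree. -/
def Kb.shiftSingleIso (i : ℤ) (M : C) : (Kb.single i M)⟦i⟧ ≅ Kb.single 0 M :=
  (boundedHomotopy C).isoMk (((boundedHomotopy C).ι.commShiftIso i).app _ ≪≫
    ((HomotopyCategory.quotient C (.up ℤ)).commShiftIso i).symm.app _ ≪≫
    (HomotopyCategory.quotient C (.up ℤ)).mapIso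
      (((CochainComplex.singleFunctors C).shiftIso i 0 i (add_zero i)).app M))

/-- A retract of complexes is a retract in the bounded homotopy category. -/
def Kb.retractOf {K L : Kb C} (r : Retract K.obj.as L.obj.as) : Retract K L where
  i := ObjectProperty.homMk ((HomotopyCategory.quotient C (.up ℤ)).map r.i)
  r := ObjectProperty.homMk ((HomotopyCategory.quotient C (.up ℤ)).map r.r)
  retract := by
    ext
    exact (r.map (HomotopyCategory.quotient C (.up ℤ))).retract

variable [MonoidalCategory C] [MonoidalPreadditive C]

lemma nonempty_tensorKbObj_single_zero_iso (M : C) (L : Kb C) :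
    Nonempty ((mapKb (tensorLeft M)).obj L ≅ tensorKbObj (Kb.single 0 M) L) := by
  have : HomologicalComplex.HasTensor
    ((HomologicalComplex.single C (.up ℤ) 0).obj M) L.obj.as := hasTensor_Kb (Kb.single 0 M) L
  obtain ⟨e⟩ := nonempty_tensorObj_single_zero_iso M L.obj.as
  exact ⟨(boundedHomotopy C).isoMk ((HomotopyCategory.quotient C (.up ℤ)).mapIso e)⟩

/-- `derivedTensor` is a bare bifunctor without unit constraints; this isomorphism of complexes
takes their place. -/
lemma nonempty_tensorKbObj_unit_iso (L : Kb C) :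
    Nonempty (tensorKbObj (Kb.single 0 (𝟙_ C)) L ≅ L) := by
  obtain ⟨e⟩ := nonempty_tensorKbObj_single_zero_iso (𝟙_ C) L
  let e' : ((tensorLeft (𝟙_ C)).mapHomologicalComplex (.up ℤ)).obj L.obj.as ≅ L.obj.as :=
    HomologicalComplex.Hom.isoOfComponents (fun i => λ_ (L.obj.as.X i))
      (fun i j _ => (leftUnitor_naturality (L.obj.as.d i j)).symm)
  exact ⟨e.symm ≪≫ (boundedHomotopy C).isoMk ((HomotopyCategory.quotient C (.up ℤ)).mapIso e')⟩

end SingleShift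

/-! ### Representations supported at one vertex, and maximality of the vertex ideals. -/

section Classification

universe u v w
variable {k : Type u} [Field k] {V : Type v} [Quiver.{w} V] (R : Relations k V)

lemma vertexIdeal_Q_obj_iff' (n : V) (K : Kb (RelRep R)) :
    vertexIdeal R n ((Db.Q _).obj K) ↔
      ∀ i, IsZero ((vertexFunctor R n).obj (K.obj.as.homology i)) := by
  rw [vertexIdeal_Q_obj_iff, acyclicKb_iff]
  exact forall_congr' (fun i => Iso.isZero_iff
    ((K.obj.as.sc i).mapHomologyIso (vertexFunctor R n)))

lemma vertexFunctor_hom_ext {n : V} {M N : RelRep R}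
    (hM : ∀ m, m ≠ n → IsZero ((vertexFunctor R m).obj M)) (f g : M ⟶ N)
    (h : (vertexFunctor R n).map f = (vertexFunctor R n).map g) : f = g := by
  ext x : 3
  apply (forget₂ (FGModuleCat.{u} k) (ModuleCat.{u} k)).map_injective
  by_cases hx : (show V from x) = n
  · subst hx
    exact h
  · exact (hM x hx).eq_of_src _ _

/-- Extend the linear map at `n` by zero. Naturality only matters for paths from `n` to `n`, and
these are trivial by acyclicity. Together with `vertexFunctor_hom_ext`, evaluation at `n` is fully
faithful on representations supported there. -/
lemma exists_vertexFunctor_map_eq [FiniteOrdered V] {n : V} {M N : RelRep R}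
    (hM : ∀ m, m ≠ n → IsZero ((vertexFunctor R m).obj M))
    (hN : ∀ m, m ≠ n → IsZero ((vertexFunctor R m).obj N))
    (φ : (vertexFunctor R n).obj M ⟶ (vertexFunctor R n).obj N) :
    ∃ f : M ⟶ N, (vertexFunctor R n).map f = φ := by
  classical
  let φ' : M.obj.obj ((Paths.of V).obj n) ⟶ N.obj.obj ((Paths.of V).obj n) :=
    (forget₂ (FGModuleCat.{u} k) (ModuleCat.{u} k)).preimage φ
  let ψ (x : V) : M.obj.obj ((Paths.of V).obj x) ⟶ N.obj.obj ((Paths.of V).obj x) :=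
    if h : n = x then h ▸ φ' else 0
  have hψ : ψ n = φ' := by simp [ψ]
  refine ⟨ObjectProperty.homMk { app := ψ, naturality := ?_ }, ?_⟩
  · intro (a : V) (b : V) (f : Quiver.Path a b)
    apply (forget₂ (FGModuleCat.{u} k) (ModuleCat.{u} k)).map_injective
    by_cases ha : a = n
    · by_cases hb : b = n
      · subst ha hb
        obtain rfl := FiniteOrdered.acyclic _ f
        congr 1
        exact (congrArg (· ≫ ψ _) (M.obj.map_id _)).trans ((Category.id_comp _).trans
          ((Category.comp_id _).symm.trans (congrArg (ψ _ ≫ ·) (N.obj.map_id _)).symm))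
      · exact (hN b hb).eq_of_tgt _ _
    · exact (hM a ha).eq_of_src _ _
  · change (forget₂ (FGModuleCat.{u} k) (ModuleCat.{u} k)).map (ψ n) = φ
    rw [hψ]
    exact (forget₂ (FGModuleCat.{u} k) (ModuleCat.{u} k)).map_preimage φ

variable [FiniteOrdered V] [IsTensorRelations R]

lemma isZero_vertexFunctor_simpleRep_tensor {m n : V} (h : m ≠ n) (M : RelRep R) :
    IsZero ((vertexFunctor R m).obj (simpleRep R n ⊗ M)) :=
  IsZero.of_iso (Functor.map_isZero (tensorRight ((vertexFunctor R m).obj M))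
    (isZero_vertexFunctor_simpleRep R h))
    (Functor.Monoidal.μIso (vertexFunctor R m) (simpleRep R n) M).symm

open Functor.LaxMonoidal Functor.OplaxMonoidal in
/-- If the cohomology of a complex is nonzero at a vertex, then a shift of the simple representation
is a direct summand of the tensor product of the complex with the simple representation. -/
lemma exists_retract_simpleRep_tensor (n : V) (K : CochainComplex (RelRep R) ℤ) (i : ℤ)
    (h : ¬ IsZero ((vertexFunctor R n).obj (K.homology i))) :
    Nonempty (Retract ((HomologicalComplex.single _ (.up ℤ) i).obj (simpleRep R n))
      (((tensorLeft (simpleRep R n)).mapHomologicalComplex (.up ℤ)).obj K)) := by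
  let F := vertexFunctor R n
  let S := simpleRep R n
  -- A split cycle exists at the vertex `n`. Tensoring it with the space of `S` at `n` keeps it
  -- split, and full faithfulness lifts the result to `S ⟶ S ⊗ K.X i ⟶ S`, as all these objects are
  -- supported at `n`.
  obtain ⟨a, b, ha, hb, hab⟩ := exists_split_cycle
    ((F.mapHomologicalComplex (.up ℤ)).obj K) i
    (fun H => h (H.of_iso ((K.sc i).mapHomologyIso F).symm))
  change 𝟙_ _ ⟶ F.obj (K.X i) at a
  change F.obj (K.X i) ⟶ 𝟙_ _ at b
  replace ha : a ≫ F.map (K.d i (i + 1)) = 0 := ha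
  replace hb : F.map (K.d (i - 1) i) ≫ b = 0 := hb
  replace hab : a ≫ b = 𝟙 _ := hab
  have hS (m : V) (hm : m ≠ n) := isZero_vertexFunctor_simpleRep R hm
  have hS' (j : ℤ) (m : V) (hm : m ≠ n) := isZero_vertexFunctor_simpleRep_tensor R hm (K.X j)
  obtain ⟨a', ha'⟩ := exists_vertexFunctor_map_eq R hS (hS' i)
    ((ρ_ (F.obj S)).inv ≫ F.obj S ◁ a ≫ μ F S (K.X i))
  obtain ⟨b', hb'⟩ := exists_vertexFunctor_map_eq R (hS' i) hS
    (δ F S (K.X i) ≫ F.obj S ◁ b ≫ (ρ_ (F.obj S)).hom)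
  refine nonempty_retract_single _ i a' b' ?_ ?_ ?_
  · apply vertexFunctor_hom_ext R hS
    refine (F.map_comp a' (S ◁ K.d i (i + 1))).trans ?_
    rw [ha', Category.assoc, Category.assoc, ← μ_natural_right,
      ← MonoidalCategory.whiskerLeft_comp_assoc, ha,
      MonoidalPreadditive.whiskerLeft_zero, zero_comp, comp_zero]
    exact (F.map_zero _ _).symm
  · apply vertexFunctor_hom_ext R (hS' (i - 1))
    refine (F.map_comp (S ◁ K.d (i - 1) i) b').trans ?_
    rw [hb', ← δ_natural_right_assoc, ← MonoidalCategory.whiskerLeft_comp_assoc, hb,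
      MonoidalPreadditive.whiskerLeft_zero, zero_comp, comp_zero]
    exact (F.map_zero _ _).symm
  · apply vertexFunctor_hom_ext R hS
    refine (F.map_comp a' b').trans ?_
    rw [ha', hb', F.map_id]
    simp only [Category.assoc, Functor.Monoidal.μ_δ_assoc]
    rw [← MonoidalCategory.whiskerLeft_comp_assoc, hab,
      MonoidalCategory.whiskerLeft_id, Category.id_comp, Iso.inv_hom_id]

/-- Tensor the roof from the unit to the simple representation with `K`. Both legs stay invertible
at `n`, so their cones lie in `P_n`, hence in `P`. -/
lemma prop_iff_prop_simpleRep_tensor {P : ObjectProperty (Db (RelRep R))} [P.IsTriangulated]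
    [P.IsClosedUnderIsomorphisms] (n : V) (hP : vertexIdeal R n ≤ P) (K : Kb (RelRep R)) :
    P ((Db.Q _).obj K) ↔ P ((Db.Q _).obj (tensorKbObj (Kb.single 0 (simpleRep R n)) K)) := by
  have key {M N : RelRep R} (f : M ⟶ N) [IsIso ((vertexFunctor R n).map f)] :
      P ((Db.Q _).obj (tensorKbObj (Kb.single 0 M) K)) ↔
        P ((Db.Q _).obj (tensorKbObj (Kb.single 0 N) K)) := by
    have := isIso_mapKb_map_singleMap (vertexFunctor R n) 0 f
    exact prop_iff_of_trW hP _ (trW_vertexIdeal R (tensorKbHom (Kb.singleMap 0 f) (𝟙 K))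
      (isIso_mapKb_tensorKbHom (vertexFunctor R n) _ _))
  obtain ⟨e⟩ := nonempty_tensorKbObj_unit_iso K
  rw [← key (upperRepToSimple R n), key (upperRepToUnit R n)]
  exact (P.prop_iff_of_iso ((Db.Q _).mapIso e)).symm

/-- `P_n` is maximal among proper ideals: an object of `P` outside `P_n` yields the simple
representation at `n`, and this generates everything modulo `P_n`. -/
lemma eq_vertexIdeal_of_le {P : ObjectProperty (Db (RelRep R))}
    (hP : IsPrimeTensorIdeal (derivedTensor R) P) (n : V) (h : vertexIdeal R n ≤ P) :
    P = vertexIdeal R n := by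
  have := hP.triangulated
  have := hP.thick
  refine le_antisymm (fun X hX => ?_) h
  by_contra hX'
  obtain ⟨K, ⟨e⟩⟩ := Db.exists_iso X
  rw [← P.prop_iff_of_iso e, prop_iff_prop_simpleRep_tensor R n h] at hX
  rw [← (vertexIdeal R n).prop_iff_of_iso e, vertexIdeal_Q_obj_iff', not_forall] at hX'
  obtain ⟨i, hi⟩ := hX'
  obtain ⟨r⟩ := exists_retract_simpleRep_tensor R n K.obj.as i hi
  obtain ⟨ε⟩ := nonempty_tensorKbObj_single_zero_iso (simpleRep R n) K
  have h₁ : P ((Db.Q _).obj (Kb.single i (simpleRep R n))) :=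
    P.prop_of_retract ((Kb.retractOf (K := Kb.single i (simpleRep R n))
      (L := (mapKb (tensorLeft (simpleRep R n))).obj K) r).map (Db.Q _))
      (P.prop_of_iso ((Db.Q _).mapIso ε.symm) hX)
  -- Shifting by `i` moves the summand from degree `i` to degree `0`.
  have h₂ : P ((Db.Q _).obj (Kb.single 0 (simpleRep R n))) :=
    P.prop_of_iso (((Db.Q _).commShiftIso i).symm.app _ ≪≫
      (Db.Q _).mapIso (Kb.shiftSingleIso i (simpleRep R n))) (P.le_shift i _ h₁)
  obtain ⟨Y, hY⟩ := hP.proper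
  obtain ⟨L, ⟨e'⟩⟩ := Db.exists_iso Y
  -- The ideal contains the simple representation tensored with `L`, hence `L` itself, contradicting
  -- the choice of `Y`.
  exact hY (P.prop_of_iso e' ((prop_iff_prop_simpleRep_tensor R n h L).2
    (P.prop_of_iso (derivedTensorIso R _ _) (hP.tensor_mem _ _ h₂))))

/-- The simple representations are the test objects showing that the vertex ideals are proper,
pairwise distinct and closed points. -/
lemma vertexIdeal_single_simpleRep_iff (m n : V) :
    vertexIdeal R m ((Db.Q _).obj (Kb.single 0 (simpleRep R n))) ↔ m ≠ n := by
  rw [vertexIdeal_Q_obj_iff']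
  refine ⟨?_, fun h i => ?_⟩
  · rintro h rfl
    exact not_isZero_vertexFunctor_simpleRep R m (IsZero.of_iso (h 0) ((vertexFunctor R m).mapIso
      (HomologicalComplex.singleObjHomologySelfIso (.up ℤ) 0 (simpleRep R m)).symm))
  · by_cases hi : i = 0
    · subst hi
      exact (isZero_vertexFunctor_simpleRep R h).of_iso ((vertexFunctor R m).mapIso
        (HomologicalComplex.singleObjHomologySelfIso (.up ℤ) 0 (simpleRep R n)))
    · exact Functor.map_isZero _ (HomologicalComplex.exactAt_iff_isZero_homology _ _ |>.1
        (HomologicalComplex.exactAt_single_obj (.up ℤ) 0 (simpleRep R n) i hi))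

lemma isPrimeTensorIdeal_vertexIdeal (n : V) :
    IsPrimeTensorIdeal (derivedTensor R) (vertexIdeal R n) where
  toIsTensorIdeal := isTensorIdeal_vertexIdeal R n
  proper := ⟨_, fun h => (vertexIdeal_single_simpleRep_iff R n n).1 h rfl⟩
  mem_or_mem X Y h := (vertexIdeal_tensor_iff R n X Y).1 h

/-- The prime ideal attached to a vertex, as a point of the spectrum. -/
def vertexPoint (n : V) : Spc (derivedTensor R) :=
  ⟨vertexIdeal R n, isPrimeTensorIdeal_vertexIdeal R n⟩

lemma vertexPoint_bijective : Function.Bijective (vertexPoint R) := by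
  refine ⟨fun m n h => ?_, fun P => ?_⟩
  · by_contra hmn
    have h₁ : vertexIdeal R m = vertexIdeal R n := congrArg Subtype.val h
    have h₂ := (vertexIdeal_single_simpleRep_iff R m n).2 hmn
    rw [h₁] at h₂
    exact (vertexIdeal_single_simpleRep_iff R n n).1 h₂ rfl
  · have := FiniteOrdered.finite_vertices (V := V)
    obtain ⟨n, hn⟩ := exists_vertexIdeal_le R P.2
    exact ⟨n, Subtype.ext (eq_vertexIdeal_of_le R P.2 n hn).symm⟩

instance : Finite (Spc (derivedTensor R)) :=
  have := FiniteOrdered.finite_vertices (V := V)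
  Finite.of_surjective _ (vertexPoint_bijective R).2

lemma discreteTopology_spc : DiscreteTopology (Spc (derivedTensor R)) := by
  have : T1Space (Spc (derivedTensor R)) := ⟨fun P => by
    obtain ⟨n, rfl⟩ := (vertexPoint_bijective R).2 P
    rw [← isOpen_compl_iff]
    -- In a topology given by its closed sets, openness means that the complement is a `Z(S)`. Here
    -- `S` consists of the simple representation at `n`, which only `P_n` avoids.
    change ({vertexPoint R n}ᶜ)ᶜ ∈ {Z | ∃ S, Z = Spc.zeroLocus S}
    refine ⟨{(Db.Q _).obj (Kb.single 0 (simpleRep R n))}, ?_⟩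
    rw [compl_compl]
    ext Q
    obtain ⟨m, rfl⟩ := (vertexPoint_bijective R).2 Q
    have h : (∀ X ∈ ({(Db.Q _).obj (Kb.single 0 (simpleRep R n))} : Set (Db (RelRep R))),
        ¬ vertexIdeal R m X) ↔ m = n := by
      simp [vertexIdeal_single_simpleRep_iff]
    exact (vertexPoint_bijective R).1.eq_iff.trans h.symm⟩
  -- A finite T1 space is discrete.
  infer_instance

lemma card_spc : Nat.card (Spc (derivedTensor R)) = Nat.card V :=
  (Nat.card_eq_of_bijective _ (vertexPoint_bijective R)).symm

end Classification

end QuiverSpc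

end

/-- For a finite ordered quiver with tensor relations, the spectrum of the tensor triangulated
category `D(Q)` (the bounded derived category of finite dimensional representations) is the
discrete space of the pairwise distinct prime ideals `P_n`, for `n` a vertex; in particular, two
such spectra are homeomorphic if and only if the quivers have the same number of vertices. -/
theorem mainTheorem2 {k : Type*} [Field k] {V : Type*} [Quiver V] [QuiverSpc.FiniteOrdered V]
    (R : QuiverSpc.Relations k V) [QuiverSpc.IsTensorRelations R] :
    (∃ h : ∀ n : V, QuiverSpc.IsPrimeTensorIdeal (QuiverSpc.derivedTensor R)
        (QuiverSpc.vertexIdeal R n),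
      Function.Bijective (fun n : V =>
        (⟨QuiverSpc.vertexIdeal R n, h n⟩ : QuiverSpc.Spc (QuiverSpc.derivedTensor R)))) ∧
    DiscreteTopology (QuiverSpc.Spc (QuiverSpc.derivedTensor R)) ∧
    (∀ {k' : Type*} [Field k'] {V' : Type*} [Quiver V'] [QuiverSpc.FiniteOrdered V']
      (R' : QuiverSpc.Relations k' V') [QuiverSpc.IsTensorRelations R'],
      Nonempty (QuiverSpc.Spc (QuiverSpc.derivedTensor R) ≃ₜ
        QuiverSpc.Spc (QuiverSpc.derivedTensor R')) ↔ Nat.card V = Nat.card V') := by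
  have h₁ := QuiverSpc.discreteTopology_spc R
  refine ⟨⟨QuiverSpc.isPrimeTensorIdeal_vertexIdeal R, QuiverSpc.vertexPoint_bijective R⟩, h₁, ?_⟩
  intro k' _ V' _ _ R' _
  have h₂ := QuiverSpc.discreteTopology_spc R'
  rw [← QuiverSpc.card_spc R, ← QuiverSpc.card_spc R']
  refine ⟨fun ⟨e⟩ => Nat.card_congr e.toEquiv, fun h => ?_⟩
  -- Both spectra are finite and discrete, so equal cardinality gives a bijection and any bijection
  -- is a homeomorphism.
  obtain ⟨e⟩ := Finite.card_eq.1 h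
  exact ⟨⟨e, continuous_of_discreteTopology, continuous_of_discreteTopology⟩⟩
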